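/- Let $\Sigma$ be a compact smooth 3-manifold without boundary and $\Lambda\in\mathbb R$. For a Riemannian metric $g_{ab}$, a symmetric contravariant 2-tensor density $\pi^{ab}$ of weight one and a function $\phi$ on $\Sigma$, put $\pi=\pi^{ab}g_{ab}$, $\langle\pi\rangle=\int_\Sigma \pi\,d^3x\big/\int_\Sigma\sqrt g\,d^3x$, $$\frac{S}{\sqrt g}(g,\pi)=\frac1g\Big(\pi^{ab}\pi_{ab}-\tfrac12\pi^2\Big)-R[g]+2\Lambda ,$$ $$T_\phi g_{ab}=e^{4\phi}g_{ab},\qquad T_\phi\pi^{ab}=e^{-4\phi}\Big(\pi^{ab}-\tfrac13\langle\pi\rangle\,(1-e^{6\phi})\,g^{ab}\sqrt g\Big),$$ and let $T_\phi\frac{S}{\sqrt g}$ be the value of $S/\sqrt g$ at $(T_\phi g,T_\phi\pi)$. Let $(g_\epsilon,\pi_\epsilon,\phi_\epsilon)$, $|\epsilon|<\delta$, be a family of such data that is jointly smooth in $\epsilon$ and the point of $\Sigma$, with background $(g_0,\pi_0)$ and perturbations $h_{(k)},p_{(k)}$ defined as the coefficients of $\epsilon^k$ in $g_\epsilon,\pi_\epsilon$,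 $k\ge1$ (for example $g_\epsilon=g_0+\epsilon h$, $\pi_\epsilon=\pi_0+\epsilon p$). Let $\omega_{(k)}$ be the coefficient of $\epsilon^k$ in $\Omega^6$, where $\Omega=e^{\phi_\epsilon}$, and write $h_{(0)}=g_0$, $p_{(0)}=\pi_0$. (Here the coefficient of $\epsilon^k$ means $\frac1{k!}\frac{d^k}{d\epsilon^k}\big|_{\epsilon=0}$.) Then $\epsilon\mapsto T_{\phi_\epsilon}\frac{S}{\sqrt g}(g_\epsilon,\pi_\epsilon)(x)$ is smooth at $\epsilon=0$ for every $x\in\Sigma$, and for every $n>0$ its coefficient of $\epsilon^n$ equals $$\tfrac43\big(\nabla^2+m_{(n)}^2\big)\frac{\omega_{(n)}}{\omega_{(0)}}-f_{(n)} .$$ In particular, if $T_{\phi_\epsilon}\frac{S}{\sqrt g}(g_\epsilon,\pi_\epsilon)=\mathcal H_{\rm dual}(\epsilon)$ on $\Sigma$ for all small $\epsilon$, with $\mathcal H_{\rm dual}(\epsilon)$ constant on $\Sigma$ and with coefficients $H_{(n)}$, then for every $n>0$ $$H_{(n)}=\tfrac43\big(\nabla^2+m_{(n)}^2\big)\frac{\omega_{(n)}}{\omega_{(0)}}-f_{(n)}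 .$$ Here - $\nabla^2$ is the Laplace-Beltrami operator of the background metric $\omega_{(0)}^{2/3}g_0$ (so for $\omega_{(0)}\equiv1$ the operator is $\tfrac43(\nabla^2+m^2_{(n)})\omega_{(n)}$ with $\nabla^2$ the Laplacian of $g_0$), and $m_{(n)}^2$ is a real-valued function on $\Sigma$, not necessarily positive, that depends only on the background $g_0,\pi_0,\omega_{(0)}$; - $f_{(n)}$ depends only on $\omega_{(i)}$ for $0\le i<n$ and on $h_{(k)},p_{(k)}$ for $0\le k\le n$, and it is homogeneous of total order $n$ in the perturbations: replacing $\omega_{(i)},h_{(k)},p_{(k)}$ by $s^i\omega_{(i)},s^kh_{(k)},s^kp_{(k)}$ multiplies it by $s^n$, for every real $s$. -/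

import Mathlib

open scoped Manifold ContDiff Topology

namespace ShapeDynamics

noncomputable section

/-- The model space of a three-dimensional manifold. -/
abbrev E3 : Type := EuclideanSpace ℝ (Fin 3)

/-- Component matrices of rank-two tensors in dimension three. -/
abbrev Mat3 : Type := Matrix (Fin 3) (Fin 3) ℝ

/-! ### Riemannian geometry of a coordinate metric on (an open subset of) `ℝ³` -/

/-- The coordinate partial derivative `∂ᵢ f`. -/
def pd (i : Fin 3) (f : E3 → ℝ) (y : E3) : ℝ :=
  fderiv ℝ f y (EuclideanSpace.single i 1)

/-- Christoffel symbols `Γᵏᵢⱼ = ½ gᵏˡ (∂ᵢ gⱼₗ + ∂ⱼ gᵢₗ - ∂ₗ gᵢⱼ)`. -/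
def christoffel (G : E3 → Mat3) (k i j : Fin 3) (y : E3) : ℝ :=
  (1 / 2) * ∑ l, (G y)⁻¹ k l *
    (pd i (fun z => G z j l) y + pd j (fun z => G z i l) y - pd l (fun z => G z i j) y)

/-- Scalar curvature
`R = gⁱʲ (∂ₖ Γᵏᵢⱼ - ∂ⱼ Γᵏᵢₖ + Γᵏᵢⱼ Γˡₖₗ - Γᵏᵢₗ Γˡⱼₖ)`
(positive on round spheres). -/
def coordScalarCurvature (G : E3 → Mat3) (y : E3) : ℝ :=
  ∑ i, ∑ j, (G y)⁻¹ i j *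
    ((∑ k, (pd k (christoffel G k i j) y - pd j (christoffel G k i k) y)) +
      ∑ k, ∑ l, (christoffel G k i j y * christoffel G l k l y
        - christoffel G k i l y * christoffel G l j k y))

/-- Laplace-Beltrami operator `∇² u = gⁱʲ (∂ᵢ ∂ⱼ u - Γᵏᵢⱼ ∂ₖ u)`. -/
def coordLaplacian (G : E3 → Mat3) (u : E3 → ℝ) (y : E3) : ℝ :=
  ∑ i, ∑ j, (G y)⁻¹ i j * (pd i (pd j u) y - ∑ k, christoffel G k i j y * pd k u y)

/-! ### Tensor fields on a three-manifold

The tangent space `TangentSpace (𝓡 3) x` is `ℝ³`, identified through the preferred chart at `x`.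
A rank-two tensor (or tensor density) field is recorded as a function `M → Mat3`, and a scalar
density as a function `M → ℝ`: the value at `x` holds the components at `x` in the preferred
chart at `x`.  The components at `x` in the preferred chart at another point `c` are obtained from
these by the tensor transformation law. -/

section Fields

variable {M : Type*} [TopologicalSpace M] [ChartedSpace E3 M] [IsManifold (𝓡 3) ∞ M]

/-- Jacobian at `x` of the change from the preferred chart at `c` to the preferred chart at `x`. -/
def jac (c x : M) : Mat3 :=
  Matrix.of fun k i => (tangentCoordChange (𝓡 3) c x x (EuclideanSpace.single i 1 : E3) : E3) k

/-- Components `gᵢⱼ`, in the chart at `c`, of a covariant 2-tensor field, as functions of the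
coordinates. -/
def covComp (c : M) (g : M → Mat3) (y : E3) : Mat3 :=
  let x := (extChartAt (𝓡 3) c).symm y
  (jac c x).transpose * g x * jac c x

/-- Components `πⁱʲ`, in the chart at `c`, of a contravariant 2-tensor density of weight one. -/
def densComp (c : M) (π : M → Mat3) (y : E3) : Mat3 :=
  let x := (extChartAt (𝓡 3) c).symm y
  |(jac c x).det| • ((jac c x)⁻¹ * π x * (jac c x)⁻¹.transpose)

/-- The expression, in the chart at `c`, of a scalar density of weight one. -/
def scalarDensComp (c : M) (ρ : M → ℝ) (y : E3) : ℝ :=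
  let x := (extChartAt (𝓡 3) c).symm y
  |(jac c x).det| * ρ x

/-- `g` consists of the components of a smooth Riemannian metric. -/
def IsRiemannianMetric (g : M → Mat3) : Prop :=
  ∃ G : Bundle.ContMDiffRiemannianMetric (𝓡 3) ∞ E3
      (fun x : M => TangentSpace (𝓡 3) x),
    ∀ x i j, g x i j =
      G.inner x (EuclideanSpace.single i 1 : E3) (EuclideanSpace.single j 1 : E3)

/-- The scalar curvature `R[g]`. -/
def scalarCurvature (g : M → Mat3) (x : M) : ℝ :=
  coordScalarCurvature (covComp x g) (extChartAt (𝓡 3) x x)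

/-- The Laplace-Beltrami operator `∇²` of `g` acting on functions. -/
def laplacian (g : M → Mat3) (u : M → ℝ) (x : M) : ℝ :=
  coordLaplacian (covComp x g) (fun y => u ((extChartAt (𝓡 3) x).symm y))
    (extChartAt (𝓡 3) x x)

/-- The volume density `√g`. -/
def sqrtDet (g : M → Mat3) (x : M) : ℝ := Real.sqrt (g x).det

/-- The trace `π = πᵃᵇ g_ab`, a scalar density. -/
def momTrace (g π : M → Mat3) (x : M) : ℝ := ∑ a, ∑ b, π x a b * g x a b

/-- The contraction `π · π = g_ac g_bd πᵃᵇ πᶜᵈ`. -/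
def momSq (g π : M → Mat3) (x : M) : ℝ :=
  ∑ a, ∑ b, ∑ c, ∑ d, g x a c * g x b d * π x a b * π x c d

/-- The undensitized scalar constraint of general relativity in ADM form,
`S / √g` with `S = (π·π - π²/2)/√g - √g (R[g] - 2Λ)`. -/
def scalarConstraint (Λ : ℝ) (g π : M → Mat3) (x : M) : ℝ :=
  ((momSq g π x - momTrace g π x ^ 2 / 2) / sqrtDet g x
    - sqrtDet g x * (scalarCurvature g x - 2 * Λ)) / sqrtDet g x

section Integration

variable (M) [T2Space M] [CompactSpace M]

/-- A smooth partition of unity subordinate to the preferred charts. -/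
def chartPartition : SmoothPartitionOfUnity M (𝓡 3) M Set.univ :=
  (SmoothPartitionOfUnity.exists_isSubordinate_chartAt_source (𝓡 3) M).choose

variable {M}

/-- The integral `∫ d³x ρ` of a scalar density over the compact manifold `M`. -/
def densIntegral (ρ : M → ℝ) : ℝ :=
  ∑ᶠ c : M, ∫ y in (extChartAt (𝓡 3) c).target,
    chartPartition M c ((extChartAt (𝓡 3) c).symm y) * scalarDensComp c ρ y

/-- The mean `⟨π⟩ = ∫ d³x πᵃᵇ g_ab / ∫ d³x √g` of the trace of the momentum. -/
def meanMomTrace (g π : M → Mat3) : ℝ :=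
  densIntegral (momTrace g π) / densIntegral (sqrtDet g)

/-! ### The conformal map `T_φ` -/

/-- `T_φ g = e^{4φ} g`. -/
def confMetric (φ : M → ℝ) (g : M → Mat3) (x : M) : Mat3 := Real.exp (4 * φ x) • g x

/-- `T_φ πᵃᵇ = e^{-4φ} (πᵃᵇ - ⅓ ⟨π⟩ (1 - e^{6φ}) gᵃᵇ √g)`. -/
def confMomentum (φ : M → ℝ) (g π : M → Mat3) (x : M) : Mat3 :=
  Real.exp (-4 * φ x) •
    (π x - ((1 / 3) * meanMomTrace g π * (1 - Real.exp (6 * φ x)) * sqrtDet g x) • (g x)⁻¹)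

/-- `T_φ (S / √g)`: the undensitized scalar constraint at the transformed phase-space point. -/
def transformedConstraint (Λ : ℝ) (φ : M → ℝ) (g π : M → Mat3) (x : M) : ℝ :=
  scalarConstraint Λ (confMetric φ g) (confMomentum φ g π) x

end Integration

/-! ### Perturbative expansions -/

/-- The coefficient of `εⁿ` in the expansion of `f` about `ε = 0`. -/
def epsCoeff (n : ℕ) (f : ℝ → ℝ) : ℝ := iteratedDeriv n f 0 / (n.factorial : ℝ)

/-- A one-parameter family (`|ε| < δ`) of phase-space points `(g_ε, π_ε)` and conformal factors
`φ_ε`, smooth in the parameter and the point together. -/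
structure IsSmoothFamily (δ : ℝ) (g π : ℝ → M → Mat3) (φ : ℝ → M → ℝ) : Prop where
  metric : ∀ ε ∈ Set.Ioo (-δ) δ, IsRiemannianMetric (g ε)
  momentum_symm : ∀ ε ∈ Set.Ioo (-δ) δ, ∀ x, (π ε x).IsSymm
  metric_smooth : ∀ (c : M) (i j : Fin 3),
    ContDiffOn ℝ ∞ (fun p : ℝ × E3 => covComp c (g p.1) p.2 i j)
      (Set.Ioo (-δ) δ ×ˢ (extChartAt (𝓡 3) c).target)
  momentum_smooth : ∀ (c : M) (i j : Fin 3),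
    ContDiffOn ℝ ∞ (fun p : ℝ × E3 => densComp c (π p.1) p.2 i j)
      (Set.Ioo (-δ) δ ×ˢ (extChartAt (𝓡 3) c).target)
  factor_smooth : ∀ c : M,
    ContDiffOn ℝ ∞ (fun p : ℝ × E3 => φ p.1 ((extChartAt (𝓡 3) c).symm p.2))
      (Set.Ioo (-δ) δ ×ˢ (extChartAt (𝓡 3) c).target)

/-- The `n`-th order perturbation of a tensor field: the coefficient of `εⁿ`
(the background for `n = 0`). -/
def tensorCoeff (n : ℕ) (T : ℝ → M → Mat3) (x : M) : Mat3 :=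
  Matrix.of fun i j => epsCoeff n (fun ε => T ε x i j)

/-- `ω₍ₙ₎`: the coefficient of `εⁿ` in `Ω⁶ = e^{6φ}`. -/
def omegaCoeff (n : ℕ) (φ : ℝ → M → ℝ) (x : M) : ℝ :=
  epsCoeff n (fun ε => Real.exp (6 * φ ε x))

/-- `(4/3) (∇² + m²) (w / w₀)`, where `∇²` is the Laplacian of the background metric
`Ω₀⁴ g₀ = w₀^{2/3} g₀`; for `w₀ = 1` this is `(4/3) (∇² + m²) w` with `∇²` that of `g₀`. -/
def linearOperator (g₀ : M → Mat3) (w₀ msq w : M → ℝ) (x : M) : ℝ :=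
  (4 / 3) * (laplacian (fun z => (w₀ z ^ (2 / 3 : ℝ)) • g₀ z) (fun z => w z / w₀ z) x
    + msq x * (w x / w₀ x))

end Fields

end

end ShapeDynamics

namespace ShapeDynamics
noncomputable section

open Asymptotics Filter

/-! ### Coefficients of expansions in the parameter -/

/-! The constraint at a point is local except for `⟨π⟩`, and `⟨π⟩` involves only `∫ π` and `∫ √g` of
the untransformed fields, never the conformal factor. With `w = Ω⁶`, the transformed constraint
minus `2Λ` is therefore a function `jetConstraint` of finitely many real numbers: the two-jets of
`g` and `w` at the point, the components of `π`, and the two integrals (`transformedConstraint_eq`).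
It is smooth near the background values.

A family of fields gives a smooth curve in this finite-dimensional space. The coefficient of `εⁿ` of
a smooth function along a curve sees the `n`-th coefficient of the curve only linearly, through the
differential at `ε = 0` (`epsCoeff_comp_sub`). The curve of the family is compared with the
polynomial curve built from its coefficients up to order `n`, with `ω₍ₙ₎` replaced by zero. The
polynomial curve contributes `-f₍ₙ₎` (`sourceTerm`). The two curves differ at order `n` exactly by
the jet of `ω₍ₙ₎`, so what is left is the differential of `jetConstraint` in that direction.

This differential is computed from `R[w^{2/3} g] = w^{-2/3} (R - (4/3) Δw / w + (10/9) |dw|² / w²)`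
(`coordScalarCurvature_conformal`). Linearizing `-R[w^{2/3} g]` in the direction `v` gives `4/3`
times the Laplacian of `w^{2/3} g` applied to `v / w`, with no first-order term left over, plus a
multiple of `v` (`fderiv_jetConstraint_factor`, `laplacian_div_fieldJet`). The kinetic term is
algebraic in `w` and adds another multiple of `v`. Together these multiples define `m²`, which
depends on the background only.

Homogeneity holds because weighting the `k`-th coefficients by `sᵏ` amounts to replacing `ε` by `s
ε`. That `f₍ₙ₎` depends on the coefficients alone requires coefficient extraction to commute with
spatial derivatives and with the integrals (`epsCoeff_familyJet`). -/

theorem iteratedDeriv_comp_mul_left_zero (k : ℕ) (s : ℝ) (f : ℝ → ℝ) :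
    iteratedDeriv k (fun ε => f (s * ε)) 0 = s ^ k * iteratedDeriv k f 0 := by
  rcases eq_or_ne s 0 with rfl | hs
  · rcases k with _ | k
    · simp
    · simp [iteratedDeriv_const]
  · have key : ∀ x, iteratedDeriv k (fun ε => f (s * ε)) x = s ^ k * iteratedDeriv k f (s * x) := by
      induction k with
      | zero => simp
      | succ k ih =>
        intro x
        rw [iteratedDeriv_succ, funext ih, deriv_const_mul_field, iteratedDeriv_succ,
          deriv_comp_mul_left s (iteratedDeriv k f)]
        simp only [smul_eq_mul]; ring
    simpa using key 0

/-- No smoothness is needed, since the default values of `deriv` scale as well. This is what allows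
homogeneity of the source term for arbitrary arguments. -/
theorem epsCoeff_comp_mul_left (k : ℕ) (s : ℝ) (f : ℝ → ℝ) :
    epsCoeff k (fun ε => f (s * ε)) = s ^ k * epsCoeff k f := by
  simp only [epsCoeff, iteratedDeriv_comp_mul_left_zero]; ring

theorem epsCoeff_congr {k : ℕ} {f g : ℝ → ℝ} (h : f =ᶠ[𝓝 0] g) : epsCoeff k f = epsCoeff k g := by
  simp only [epsCoeff, h.iteratedDeriv_eq]

theorem epsCoeff_zero (f : ℝ → ℝ) : epsCoeff 0 f = f 0 := by simp [epsCoeff]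

theorem epsCoeff_add_const {k : ℕ} (hk : 0 < k) (f : ℝ → ℝ) (c : ℝ) :
    epsCoeff k (fun ε => f ε + c) = epsCoeff k f := by
  simp only [epsCoeff, add_comm _ c, iteratedDeriv_const_add hk]

theorem epsCoeff_sub {k : ℕ} {f g : ℝ → ℝ} (hf : ContDiffAt ℝ ∞ f 0) (hg : ContDiffAt ℝ ∞ g 0) :
    epsCoeff k (fun ε => f ε - g ε) = epsCoeff k f - epsCoeff k g := by
  have := iteratedDeriv_sub (n := k) (hf.of_le (mod_cast le_top)) (hg.of_le (mod_cast le_top))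
  simp only [epsCoeff, ← sub_div, ← this]; rfl

theorem epsCoeff_sum {ι : Type*} {s : Finset ι} {k : ℕ} {f : ι → ℝ → ℝ}
    (hf : ∀ i ∈ s, ContDiffAt ℝ ∞ (f i) 0) :
    epsCoeff k (fun ε => ∑ i ∈ s, f i ε) = ∑ i ∈ s, epsCoeff k (f i) := by
  simp only [epsCoeff, ← Finset.sum_div]
  rw [iteratedDeriv_fun_sum fun i hi => (hf i hi).of_le (mod_cast le_top)]

theorem epsCoeff_const_mul (k : ℕ) (c : ℝ) (f : ℝ → ℝ) :
    epsCoeff k (fun ε => c * f ε) = c * epsCoeff k f := by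
  simp only [epsCoeff, mul_div_assoc, iteratedDeriv_const_mul_field]

theorem epsCoeff_mul_const (k : ℕ) (f : ℝ → ℝ) (c : ℝ) :
    epsCoeff k (fun ε => f ε * c) = epsCoeff k f * c := by
  simp only [mul_comm _ c, epsCoeff_const_mul]

theorem epsCoeff_pow (k j : ℕ) : epsCoeff k (fun ε => ε ^ j) = if k = j then 1 else 0 := by
  simp only [epsCoeff]
  rw [iteratedDeriv_fun_pow_zero]
  split_ifs with h
  · subst h; exact div_self (by positivity)
  · simp

theorem epsCoeff_polynomial {m k : ℕ} (C : Fin m → ℝ) :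
    epsCoeff k (fun ε => ∑ j : Fin m, ε ^ (j : ℕ) * C j) =
      if h : k < m then C ⟨k, h⟩ else 0 := by
  rw [epsCoeff_sum fun i _ => by fun_prop]
  simp only [epsCoeff_mul_const, epsCoeff_pow]
  split_ifs with h
  · rw [Finset.sum_eq_single ⟨k, h⟩]
    · simp
    · intro b _ hb
      rw [if_neg (fun h' => hb (Fin.ext h'.symm)), zero_mul]
    · simp
  · refine Finset.sum_eq_zero fun j _ => ?_
    rw [if_neg (by rintro rfl; exact h j.2), zero_mul]

/-- Taylor's theorem with Peano remainder, in which only the top term survives. It is applied on a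
ball, which is convex and open, so that derivatives within the ball are ordinary derivatives. -/
theorem isLittleO_sub_epsCoeff {n : ℕ} {f : ℝ → ℝ} (hf : ContDiffAt ℝ ∞ f 0)
    (h0 : ∀ k < n, epsCoeff k f = 0) :
    (fun ε => f ε - epsCoeff n f * ε ^ n) =o[𝓝 0] fun ε => ε ^ n := by
  obtain ⟨u, hu, hfu⟩ := (hf.of_le (m := n) (mod_cast le_top)).contDiffOn le_rfl (by simp)
  obtain ⟨r, hr, hru⟩ := Metric.mem_nhds_iff.1 hu
  have h := taylor_isLittleO (convex_ball (0 : ℝ) r) (Metric.mem_ball_self hr) (hfu.mono hru)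
  rw [Metric.isOpen_ball.nhdsWithin_eq (Metric.mem_ball_self hr)] at h
  simp only [sub_zero] at h
  refine h.congr_left fun ε => ?_
  rw [taylor_within_apply, Finset.sum_range_succ, Finset.sum_eq_zero, zero_add]
  · rw [iteratedDerivWithin_of_isOpen Metric.isOpen_ball (Metric.mem_ball_self hr)]
    simp only [epsCoeff, sub_zero, smul_eq_mul]; ring
  · intro k hk
    have := h0 k (Finset.mem_range.1 hk)
    rw [iteratedDerivWithin_of_isOpen Metric.isOpen_ball (Metric.mem_ball_self hr)]
    rw [epsCoeff, div_eq_zero_iff, or_iff_left (by positivity)] at this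
    rw [this, smul_zero]

theorem eq_zero_of_const_mul_pow_isLittleO {a : ℝ} {n : ℕ}
    (h : (fun ε : ℝ => a * ε ^ n) =o[𝓝 0] fun ε => ε ^ n) : a = 0 := by
  by_contra ha
  have h1 : (fun ε : ℝ => ε ^ n) =o[𝓝[≠] 0] fun ε => ε ^ n :=
    ((isLittleO_const_mul_left_iff ha).1 h).mono nhdsWithin_le_nhds
  refine isLittleO_irrefl ?_ h1
  refine Eventually.frequently ?_
  filter_upwards [self_mem_nhdsWithin] with ε hε using pow_ne_zero _ hε

/-- Uniqueness of the leading term: the bound makes `f` negligible against `εᵏ` for each `k < n`, so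
the lower coefficients vanish one after another, and Taylor's theorem then identifies the `n`-th. -/
theorem epsCoeff_of_isLittleO {n : ℕ} {f : ℝ → ℝ} {a : ℝ} (hf : ContDiffAt ℝ ∞ f 0)
    (h : (fun ε => f ε - a * ε ^ n) =o[𝓝 0] fun ε => ε ^ n) : epsCoeff n f = a := by
  have low : ∀ k < n, epsCoeff k f = 0 := by
    intro k
    induction k using Nat.strong_induction_on with
    | _ k ih =>
      intro hk
      have h1 := isLittleO_sub_epsCoeff hf fun j hj => ih j hj (hj.trans hk)
      have hnk : (fun ε : ℝ => ε ^ n) =o[𝓝 0] fun ε => ε ^ k := isLittleO_pow_pow hk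
      have h2 : f =o[𝓝 0] fun ε => ε ^ k := by
        have := (h.trans hnk).add (hnk.const_mul_left a)
        exact this.congr_left fun ε => by ring
      refine eq_zero_of_const_mul_pow_isLittleO (n := k) ((h2.sub h1).congr_left fun ε => by ring)
  have h1 := isLittleO_sub_epsCoeff hf low
  exact sub_eq_zero.1 (eq_zero_of_const_mul_pow_isLittleO (n := n)
    ((h.sub h1).congr_left fun ε => by ring))

/-- Two curves whose expansions agree below order `n` are mapped to curves whose `n`-th
coefficients differ by the differential applied to the difference of the `n`-th coefficients. -/
theorem epsCoeff_comp_sub {ι : Type*} [Fintype ι] {n : ℕ} (hn : 0 < n) {F : (ι → ℝ) → ℝ}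
    {c₁ c₂ : ι → ℝ → ℝ} (h₁ : ∀ i, ContDiffAt ℝ ∞ (c₁ i) 0) (h₂ : ∀ i, ContDiffAt ℝ ∞ (c₂ i) 0)
    (hlow : ∀ i, ∀ k < n, epsCoeff k (c₁ i) = epsCoeff k (c₂ i))
    (hF : ContDiffAt ℝ ∞ F fun i => c₁ i 0) :
    epsCoeff n (fun ε => F fun i => c₁ i ε) - epsCoeff n (fun ε => F fun i => c₂ i ε) =
      fderiv ℝ F (fun i => c₁ i 0) fun i => epsCoeff n (c₁ i) - epsCoeff n (c₂ i) := by
  set a : ι → ℝ := fun i => c₁ i 0 with ha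
  set K : ι → ℝ := fun i => epsCoeff n (c₁ i) - epsCoeff n (c₂ i) with hK
  have ha2 : a = fun i => c₂ i 0 := by
    funext i; simpa [epsCoeff_zero] using hlow i 0 hn
  have hc1 : ContDiffAt ℝ ∞ (fun ε i => c₁ i ε) 0 := contDiffAt_pi.2 h₁
  have hc2 : ContDiffAt ℝ ∞ (fun ε i => c₂ i ε) 0 := contDiffAt_pi.2 h₂
  have hF1 : ContDiffAt ℝ ∞ (fun ε => F fun i => c₁ i ε) 0 :=
    ContDiffAt.comp (g := F) (f := fun ε i => c₁ i ε) 0 hF hc1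
  have hF2 : ContDiffAt ℝ ∞ (fun ε => F fun i => c₂ i ε) 0 :=
    ContDiffAt.comp (g := F) (f := fun ε i => c₂ i ε) 0 (ha2 ▸ hF) hc2
  rw [← epsCoeff_sub hF1 hF2]
  refine epsCoeff_of_isLittleO (hF1.sub hF2) ?_
  -- The coefficients below order `n` cancel, so the difference of the curves is `εⁿ K` up to
  -- `o(εⁿ)`.
  have hd : (fun ε => (fun i => c₁ i ε) - (fun i => c₂ i ε) - ε ^ n • K) =o[𝓝 0]
      fun ε : ℝ => ε ^ n := by
    rw [isLittleO_pi]
    intro i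
    have := isLittleO_sub_epsCoeff (n := n) ((h₁ i).sub (h₂ i)) fun k hk => by
      have := epsCoeff_sub (k := k) (h₁ i) (h₂ i)
      simp only [hlow i k hk, sub_self] at this; exact this
    refine this.congr_left fun ε => ?_
    have h3 := epsCoeff_sub (k := n) (h₁ i) (h₂ i)
    simp only [Pi.sub_apply, Pi.smul_apply, smul_eq_mul, hK]
    rw [← h3, mul_comm (ε ^ n)]
  have hO : (fun ε => (fun i => c₁ i ε) - (fun i => c₂ i ε)) =O[𝓝 0] fun ε : ℝ => ε ^ n := by
    have : (fun ε : ℝ => ε ^ n • K) =O[𝓝 0] fun ε : ℝ => ε ^ n := by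
      refine IsBigO.of_bound ‖K‖ (Eventually.of_forall fun ε => ?_)
      rw [norm_smul, mul_comm]
    exact (hd.isBigO.add this).congr_left fun ε => by abel
  -- Strict differentiability is the right notion: both arguments of `F` move with `ε`, and `F(c₁) -
  -- F(c₂)` has to be compared with the differential at the common limit `a`.
  have hs : HasStrictFDerivAt F (fderiv ℝ F a) a := hF.hasStrictFDerivAt (by simp)
  have ht : Tendsto (fun ε : ℝ => ((fun i => c₁ i ε), (fun i => c₂ i ε))) (𝓝 0) (𝓝 (a, a)) := by
    refine (hc1.continuousAt.prodMk hc2.continuousAt).tendsto.trans_eq ?_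
    rw [← ha2]
  have h1 := (hs.isLittleO.comp_tendsto ht).trans_isBigO hO
  have h2 := ((fderiv ℝ F a).isBigO_comp _ _).trans_isLittleO hd
  refine (h1.add h2).congr_left fun ε => ?_
  simp only [Function.comp, map_sub, map_smul, smul_eq_mul]
  ring

theorem epsCoeff_comp_congr {ι : Type*} [Fintype ι] {n : ℕ} {F : (ι → ℝ) → ℝ}
    {c₁ c₂ : ι → ℝ → ℝ} (h₁ : ∀ i, ContDiffAt ℝ ∞ (c₁ i) 0) (h₂ : ∀ i, ContDiffAt ℝ ∞ (c₂ i) 0)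
    (hlow : ∀ i, ∀ k ≤ n, epsCoeff k (c₁ i) = epsCoeff k (c₂ i))
    (hF : ContDiffAt ℝ ∞ F fun i => c₁ i 0) :
    epsCoeff n (fun ε => F fun i => c₁ i ε) = epsCoeff n (fun ε => F fun i => c₂ i ε) := by
  rcases Nat.eq_zero_or_pos n with rfl | hn
  · have : ∀ i, c₁ i 0 = c₂ i 0 := fun i => by simpa [epsCoeff_zero] using hlow i 0 le_rfl
    simp [epsCoeff_zero, this]
  · have := epsCoeff_comp_sub hn h₁ h₂ (fun i k hk => hlow i k hk.le) hF
    have h0 : (fun i => epsCoeff n (c₁ i) - epsCoeff n (c₂ i)) = 0 := by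
      funext i; simp [hlow i n le_rfl]
    rw [h0, map_zero] at this
    exact sub_eq_zero.1 this

end
end ShapeDynamics

namespace ShapeDynamics
noncomputable section

/-! ### Algebra of the conformal change of the connection -/

section ConformalAlgebra

/-- The Kronecker symbol. -/
abbrev kron (i j : Fin 3) : ℝ := if i = j then 1 else 0

/-- The difference `δᵏᵢ aⱼ + δᵏⱼ aᵢ - gᵢⱼ Bᵏ` of two conformally related connections. -/
def connDiff (g : Fin 3 → Fin 3 → ℝ) (a B : Fin 3 → ℝ) (k i j : Fin 3) : ℝ :=
  kron k i * a j + kron k j * a i - g i j * B k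

variable {g gi : Fin 3 → Fin 3 → ℝ} {dg : Fin 3 → Fin 3 → Fin 3 → ℝ} {a B : Fin 3 → ℝ}
  {da dB : Fin 3 → Fin 3 → ℝ} {Γ : Fin 3 → Fin 3 → Fin 3 → ℝ}

theorem lower_raise (hinv : ∀ i k, ∑ j, g i j * gi j k = kron i k)
    (hB : ∀ k, B k = ∑ l, gi k l * a l) (k : Fin 3) : ∑ l, g k l * B l = a k := by
  calc ∑ l, g k l * B l = ∑ m, (∑ l, g k l * gi l m) * a m := by
        simp only [hB, Finset.mul_sum, Finset.sum_mul]
        rw [Finset.sum_comm]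
        exact Finset.sum_congr rfl fun m _ => Finset.sum_congr rfl fun l _ => by ring
    _ = a k := by simp [hinv, kron]

/-- One Kronecker term contributes `a k`, the other `3 * a k` by the dimension, and the metric term
removes one `a k`. -/
theorem connDiff_trace (hinv : ∀ i k, ∑ j, g i j * gi j k = kron i k)
    (hB : ∀ k, B k = ∑ l, gi k l * a l) (k : Fin 3) :
    ∑ l, connDiff g a B l k l = 3 * a k := by
  have h := lower_raise hinv hB k
  simp only [connDiff, Finset.sum_sub_distrib, h, Finset.sum_add_distrib]
  simp [kron]

theorem inverse_contract (hinv : ∀ i k, ∑ j, g i j * gi j k = kron i k)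
    (hgi : ∀ i j, gi i j = gi j i) : ∑ i, ∑ j, gi i j * g i j = 3 := by
  have : ∀ i, ∑ j, gi i j * g i j = 1 := fun i => by
    have := hinv i i
    rw [kron, if_pos rfl] at this
    rw [← this]
    exact Finset.sum_congr rfl fun j _ => by rw [hgi i j]; ring
  simp [this]

/-- The Kronecker terms give `B k` each and the metric term gives `-3 * B k`. This contraction is
also the source of the gradient term in the conformal change of the Laplacian. -/
theorem connDiff_contract (hinv : ∀ i k, ∑ j, g i j * gi j k = kron i k)
    (hgi : ∀ i j, gi i j = gi j i) (hB : ∀ k, B k = ∑ l, gi k l * a l) (k : Fin 3) :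
    ∑ i, ∑ j, gi i j * connDiff g a B k i j = -B k := by
  have h3 := inverse_contract hinv hgi
  have e : ∀ i j, gi i j * connDiff g a B k i j =
      kron k i * (gi i j * a j) + kron k j * (gi i j * a i) - (gi i j * g i j) * B k := by
    intro i j; simp only [connDiff]; ring
  simp only [e, Finset.sum_sub_distrib, Finset.sum_add_distrib, ← Finset.sum_mul, h3]
  have h1 : ∑ i, ∑ j, kron k i * (gi i j * a j) = B k := by
    simp [kron, hB]
  have h2 : ∑ i, ∑ j, kron k j * (gi i j * a i) = B k := by
    simp [kron, hB, hgi k]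
  rw [h1, h2]; ring

theorem connDiff_raise (hinv : ∀ i k, ∑ j, g i j * gi j k = kron i k)
    (hg : ∀ i j, g i j = g j i) (hgi : ∀ i j, gi i j = gi j i)
    (hB : ∀ k, B k = ∑ l, gi k l * a l) (j k l : Fin 3) :
    ∑ i, gi i j * connDiff g a B k i l = gi k j * a l + kron k l * B j - kron l j * B k := by
  have e : ∀ i, gi i j * connDiff g a B k i l =
      kron k i * (gi i j * a l) + kron k l * (gi j i * a i) - (g l i * gi i j) * B k := by
    intro i; simp only [connDiff, hg i l, hgi i j]; ring
  simp only [e, Finset.sum_sub_distrib, Finset.sum_add_distrib, ← Finset.sum_mul, hinv,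
    ← Finset.mul_sum, ← hB]
  simp [kron]

theorem connDiff_raise_mul (hinv : ∀ i k, ∑ j, g i j * gi j k = kron i k)
    (hg : ∀ i j, g i j = g j i) (hgi : ∀ i j, gi i j = gi j i)
    (hB : ∀ k, B k = ∑ l, gi k l * a l) (T : Fin 3 → Fin 3 → Fin 3 → ℝ) :
    ∑ i, ∑ j, gi i j * ∑ k, ∑ l, connDiff g a B k i l * T l j k =
      ∑ j, ∑ k, ∑ l, (gi k j * a l + kron k l * B j - kron l j * B k) * T l j k := by
  simp only [← connDiff_raise hinv hg hgi hB, Finset.sum_mul, Finset.mul_sum]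
  rw [Finset.sum_comm]
  refine Finset.sum_congr rfl fun j _ => ?_
  rw [Finset.sum_comm]
  refine Finset.sum_congr rfl fun k _ => ?_
  rw [Finset.sum_comm]
  refine Finset.sum_congr rfl fun l _ => Finset.sum_congr rfl fun i _ => by ring

/-- Once the index is raised, the two terms containing `B` are both traces of `Γ` against `B` and
cancel by the symmetry of `Γ`. Only `gʲᵏ aₗ Γˡⱼₖ` remains. -/
theorem connDiff_mul_symm (hinv : ∀ i k, ∑ j, g i j * gi j k = kron i k)
    (hg : ∀ i j, g i j = g j i) (hgi : ∀ i j, gi i j = gi j i)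
    (hB : ∀ k, B k = ∑ l, gi k l * a l) (hΓ : ∀ k i j, Γ k i j = Γ k j i) :
    ∑ i, ∑ j, gi i j * ∑ k, ∑ l, connDiff g a B k i l * Γ l j k =
      ∑ i, ∑ j, gi i j * ∑ k, Γ k i j * a k := by
  rw [connDiff_raise_mul hinv hg hgi hB]
  simp only [kron, Fin.sum_univ_three, Fin.isValue, Fin.reduceEq, if_true, if_false, zero_mul,
    one_mul, hΓ _ 1 0, hΓ _ 2 0, hΓ _ 2 1]
  ring

theorem symm_mul_connDiff (hinv : ∀ i k, ∑ j, g i j * gi j k = kron i k)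
    (hg : ∀ i j, g i j = g j i) (hgi : ∀ i j, gi i j = gi j i)
    (hB : ∀ k, B k = ∑ l, gi k l * a l) (hΓ : ∀ k i j, Γ k i j = Γ k j i) :
    ∑ i, ∑ j, gi i j * ∑ k, ∑ l, Γ k i l * connDiff g a B l j k =
      ∑ i, ∑ j, gi i j * ∑ k, Γ k i j * a k := by
  rw [← connDiff_mul_symm hinv hg hgi hB hΓ, Finset.sum_comm]
  refine Finset.sum_congr rfl fun j _ => Finset.sum_congr rfl fun i _ => ?_
  rw [hgi i j, Finset.sum_comm]
  congr 1
  exact Finset.sum_congr rfl fun l _ => Finset.sum_congr rfl fun k _ => by rw [mul_comm]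

/-- `connDiff` is itself symmetric in its lower indices for symmetric `g`, so the same cancellation
occurs, and the surviving contraction is `-aₗ Bˡ`. The verification is in components. -/
theorem connDiff_mul_connDiff (hinv : ∀ i k, ∑ j, g i j * gi j k = kron i k)
    (hg : ∀ i j, g i j = g j i) (hgi : ∀ i j, gi i j = gi j i)
    (hB : ∀ k, B k = ∑ l, gi k l * a l) :
    ∑ i, ∑ j, gi i j * ∑ k, ∑ l, connDiff g a B k i l * connDiff g a B l j k =
      -∑ i, ∑ j, gi i j * (a i * a j) := by
  have h3 := inverse_contract hinv hgi
  rw [connDiff_raise_mul hinv hg hgi hB]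
  simp only [Fin.sum_univ_three] at h3 hB ⊢
  simp only [connDiff, kron, Fin.isValue, Fin.reduceEq, if_true, if_false, zero_mul, one_mul,
    hg 1 0, hg 2 0, hg 2 1, hgi 1 0, hgi 2 0, hgi 2 1] at h3 hB ⊢
  linear_combination (-(a 0 * B 0 + a 1 * B 1 + a 2 * B 2)) * h3
    - 3 * (a 0 * hB 0 + a 1 * hB 1 + a 2 * hB 2)
    + 3 * (a 0 * a 1 * hgi 0 1 + a 0 * a 2 * hgi 0 2 + a 1 * a 2 * hgi 1 2)

/-- The derivative of `connDiff`. -/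
def connDiffDeriv (g : Fin 3 → Fin 3 → ℝ) (dg : Fin 3 → Fin 3 → Fin 3 → ℝ) (B : Fin 3 → ℝ)
    (da dB : Fin 3 → Fin 3 → ℝ) (m k i j : Fin 3) : ℝ :=
  kron k i * da m j + kron k j * da m i - (dg m i j * B k + g i j * dB m k)

/-- The Christoffel symbols in terms of the inverse metric and the derivatives of the metric. -/
def christoffelOf (gi : Fin 3 → Fin 3 → ℝ) (dg : Fin 3 → Fin 3 → Fin 3 → ℝ)
    (k i j : Fin 3) : ℝ :=
  (1 / 2) * ∑ l, gi k l * (dg i j l + dg j i l - dg l i j)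

theorem christoffelOf_symm (hdg : ∀ m i j, dg m i j = dg m j i) (k i j : Fin 3) :
    christoffelOf gi dg k i j = christoffelOf gi dg k j i := by
  simp only [christoffelOf]
  congr 1
  exact Finset.sum_congr rfl fun l _ => by rw [hdg l i j]; ring

theorem christoffelOf_trace (hgi : ∀ i j, gi i j = gi j i) (hdg : ∀ m i j, dg m i j = dg m j i)
    (k : Fin 3) :
    ∑ l, christoffelOf gi dg l k l = (1 / 2) * ∑ i, ∑ j, gi i j * dg k i j := by
  simp only [christoffelOf, ← Finset.mul_sum]
  congr 1
  simp only [Fin.sum_univ_three, hgi 1 0, hgi 2 0, hgi 2 1, hdg _ 1 0, hdg _ 2 0, hdg _ 2 1]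
  ring

/-- The left side is `∂ₖ gᵏˡ` by the rule for differentiating an inverse matrix. The identity is
metric compatibility, `∂ₖ gᵏˡ = -gⁱʲ Γˡᵢⱼ - gˡᵐ Γⁱₘᵢ`, with the trace of `Γ` written out as in
`christoffelOf_trace`. -/
theorem inverse_deriv_contract (hgi : ∀ i j, gi i j = gi j i)
    (hdg : ∀ m i j, dg m i j = dg m j i) (l : Fin 3) :
    -∑ k, ∑ c, ∑ b, gi k c * dg k c b * gi b l =
      -(∑ i, ∑ j, gi i j * christoffelOf gi dg l i j)
        - (1 / 2) * ∑ m, gi l m * ∑ i, ∑ j, gi i j * dg m i j := by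
  simp only [christoffelOf, hgi l]
  simp only [Fin.sum_univ_three, hgi 1 0, hgi 2 0, hgi 2 1, hdg _ 1 0, hdg _ 2 0, hdg _ 2 1]
  ring

/-- The derivative of `connDiff_trace`. The hypothesis `hdB` is the product rule for `Bᵏ = gᵏˡ aₗ`,
and `e` is the derivative of `gᵢₖ Bᵏ = aᵢ`. -/
theorem connDiffDeriv_trace (hinv : ∀ i k, ∑ j, g i j * gi j k = kron i k)
    (hB : ∀ k, B k = ∑ l, gi k l * a l)
    (hdB : ∀ m k, dB m k = ∑ l, ((-∑ c, ∑ b, gi k c * dg m c b * gi b l) * a l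
      + gi k l * da m l)) (m i : Fin 3) :
    ∑ k, connDiffDeriv g dg B da dB m k i k = 3 * da m i := by
  have e : ∑ k, (dg m i k * B k + g i k * dB m k) = da m i := by
    have h1 : ∀ k, dB m k = ∑ c, gi k c * (da m c - ∑ b, dg m c b * B b) := by
      intro k
      rw [hdB]
      simp only [hB, Fin.sum_univ_three]
      ring
    rw [Finset.sum_add_distrib, lower_raise hinv h1]
    ring
  simp only [connDiffDeriv, Finset.sum_sub_distrib, e]
  simp only [Finset.sum_add_distrib]
  simp [kron]

/-- Partial differentiation does not commute with contraction by `gⁱʲ`. The resulting Christoffel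
terms help turn `∂ᵢ aⱼ` into a covariant derivative in the curvature identity. -/
theorem connDiffDeriv_contract (hinv : ∀ i k, ∑ j, g i j * gi j k = kron i k)
    (hgi : ∀ i j, gi i j = gi j i) (hdg : ∀ m i j, dg m i j = dg m j i)
    (hB : ∀ k, B k = ∑ l, gi k l * a l)
    (hdB : ∀ m k, dB m k = ∑ l, ((-∑ c, ∑ b, gi k c * dg m c b * gi b l) * a l
      + gi k l * da m l)) :
    ∑ i, ∑ j, gi i j * ∑ k, connDiffDeriv g dg B da dB k k i j =
      -∑ i, ∑ j, gi i j * da i j + 3 * (∑ i, ∑ j, gi i j * ∑ k, christoffelOf gi dg k i j * a k)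
        + ∑ k, B k * ∑ l, christoffelOf gi dg l k l := by
  have h3 := inverse_contract hinv hgi
  have hT := christoffelOf_trace hgi hdg
  have e1 : ∑ i, ∑ j, gi i j * ∑ k, connDiffDeriv g dg B da dB k k i j =
      2 * (∑ i, ∑ j, gi i j * da i j) - ∑ k, (∑ i, ∑ j, gi i j * dg k i j) * B k
        - (∑ i, ∑ j, gi i j * g i j) * ∑ k, dB k k := by
    simp only [connDiffDeriv, kron, Fin.sum_univ_three, Fin.isValue, Fin.reduceEq, if_true,
      if_false, zero_mul, one_mul, hgi 1 0, hgi 2 0, hgi 2 1]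
    ring
  have e2 : ∑ k, dB k k = ∑ i, ∑ j, gi i j * da i j
      + ∑ l, (-∑ k, ∑ c, ∑ b, gi k c * dg k c b * gi b l) * a l := by
    simp only [hdB, Finset.sum_add_distrib]
    rw [add_comm]
    congr 1
    rw [Finset.sum_comm]
    simp only [← Finset.sum_mul, Finset.sum_neg_distrib]
  have e3 : ∑ l, (∑ i, ∑ j, gi i j * christoffelOf gi dg l i j) * a l =
      ∑ i, ∑ j, gi i j * ∑ k, christoffelOf gi dg k i j * a k := by
    simp only [Fin.sum_univ_three]; ring
  have e4 : ∑ l, (∑ m, gi l m * ∑ i, ∑ j, gi i j * dg m i j) * a l =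
      ∑ k, B k * ∑ i, ∑ j, gi i j * dg k i j := by
    simp only [hB, Finset.sum_mul]
    rw [Finset.sum_comm]
    exact Finset.sum_congr rfl fun m _ => Finset.sum_congr rfl fun l _ => by rw [hgi l m]; ring
  simp only [inverse_deriv_contract hgi hdg] at e2
  simp only [sub_mul, neg_mul, Finset.sum_sub_distrib,
    Finset.sum_neg_distrib, e3, mul_assoc, ← Finset.mul_sum, e4] at e2
  rw [e1, h3, e2]
  simp only [hT, mul_comm (∑ i, ∑ j, gi i j * dg _ i j) (B _), mul_left_comm (B _) (1 / 2 : ℝ),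
    ← Finset.mul_sum]
  ring

/-- The contraction of the Riemann tensor giving the scalar curvature. -/
def curvatureContraction (gi : Fin 3 → Fin 3 → ℝ) (Γ : Fin 3 → Fin 3 → Fin 3 → ℝ)
    (dΓ : Fin 3 → Fin 3 → Fin 3 → Fin 3 → ℝ) : ℝ :=
  ∑ i, ∑ j, gi i j * ((∑ k, (dΓ k k i j - dΓ j k i k)) +
    ∑ k, ∑ l, (Γ k i j * Γ l k l - Γ k i l * Γ l j k))

/-- The conformal change of the scalar curvature in dimension three, as an algebraic identity. -/
theorem curvatureContraction_conformal (hinv : ∀ i k, ∑ j, g i j * gi j k = kron i k)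
    (hg : ∀ i j, g i j = g j i) (hgi : ∀ i j, gi i j = gi j i)
    (hdg : ∀ m i j, dg m i j = dg m j i) (hB : ∀ k, B k = ∑ l, gi k l * a l)
    (hdB : ∀ m k, dB m k = ∑ l, ((-∑ c, ∑ b, gi k c * dg m c b * gi b l) * a l
      + gi k l * da m l)) (dΓ : Fin 3 → Fin 3 → Fin 3 → Fin 3 → ℝ) :
    curvatureContraction gi (fun k i j => christoffelOf gi dg k i j + connDiff g a B k i j)
        (fun m k i j => dΓ m k i j + connDiffDeriv g dg B da dB m k i j) =
      curvatureContraction gi (christoffelOf gi dg) dΓ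
        - 4 * (∑ i, ∑ j, gi i j * (da i j - ∑ k, christoffelOf gi dg k i j * a k))
        - 2 * ∑ i, ∑ j, gi i j * (a i * a j) := by
  have hΓ : ∀ k i j, christoffelOf gi dg k i j = christoffelOf gi dg k j i :=
    christoffelOf_symm hdg
  have s1 := connDiffDeriv_contract hinv hgi hdg hB hdB
  have s2 : ∑ i, ∑ j, gi i j * ∑ k, connDiffDeriv g dg B da dB j k i k =
      3 * ∑ i, ∑ j, gi i j * da i j := by
    simp only [connDiffDeriv_trace hinv hB hdB]
    simp only [Fin.sum_univ_three, hgi 1 0, hgi 2 0, hgi 2 1]; ring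
  have swap : ∀ (T : Fin 3 → Fin 3 → Fin 3 → ℝ) (t : Fin 3 → ℝ),
      ∑ i, ∑ j, gi i j * ∑ k, T k i j * t k = ∑ k, (∑ i, ∑ j, gi i j * T k i j) * t k := by
    intro T t
    simp only [Fin.sum_univ_three]; ring
  have s3 : ∑ i, ∑ j, gi i j * ∑ k, ∑ l, connDiff g a B k i j *
      (christoffelOf gi dg l k l + connDiff g a B l k l) =
      -∑ k, B k * (∑ l, christoffelOf gi dg l k l) - 3 * ∑ i, ∑ j, gi i j * (a i * a j) := by
    simp only [← Finset.mul_sum, Finset.sum_add_distrib, connDiff_trace hinv hB]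
    rw [swap]
    simp only [connDiff_contract hinv hgi hB]
    simp only [mul_add, Finset.sum_add_distrib, neg_mul, Finset.sum_neg_distrib, sub_eq_add_neg]
    congr 2
    simp only [hB, Fin.sum_univ_three]; ring
  have s4 : ∑ i, ∑ j, gi i j * ∑ k, ∑ l, christoffelOf gi dg k i j * connDiff g a B l k l =
      3 * ∑ i, ∑ j, gi i j * ∑ k, christoffelOf gi dg k i j * a k := by
    simp only [← Finset.mul_sum, connDiff_trace hinv hB]
    simp only [mul_left_comm _ (3 : ℝ), ← Finset.mul_sum]
  have s6 := connDiff_mul_symm hinv hg hgi hB hΓ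
  have s7 := symm_mul_connDiff hinv hg hgi hB hΓ
  have s8 := connDiff_mul_connDiff hinv hg hgi hB
  have split : curvatureContraction gi
        (fun k i j => christoffelOf gi dg k i j + connDiff g a B k i j)
        (fun m k i j => dΓ m k i j + connDiffDeriv g dg B da dB m k i j) =
      curvatureContraction gi (christoffelOf gi dg) dΓ
      + ∑ i, ∑ j, gi i j * ∑ k, connDiffDeriv g dg B da dB k k i j
      - ∑ i, ∑ j, gi i j * ∑ k, connDiffDeriv g dg B da dB j k i k
      + ∑ i, ∑ j, gi i j * ∑ k, ∑ l, connDiff g a B k i j *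
          (christoffelOf gi dg l k l + connDiff g a B l k l)
      + ∑ i, ∑ j, gi i j * ∑ k, ∑ l, christoffelOf gi dg k i j * connDiff g a B l k l
      - ∑ i, ∑ j, gi i j * ∑ k, ∑ l, connDiff g a B k i l * christoffelOf gi dg l j k
      - ∑ i, ∑ j, gi i j * ∑ k, ∑ l, christoffelOf gi dg k i l * connDiff g a B l j k
      - ∑ i, ∑ j, gi i j * ∑ k, ∑ l, connDiff g a B k i l * connDiff g a B l j k := by
    simp only [curvatureContraction, ← Finset.sum_add_distrib, ← Finset.sum_sub_distrib, ← mul_add,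
      ← mul_sub]
    refine Finset.sum_congr rfl fun i _ => Finset.sum_congr rfl fun j _ => ?_
    congr 1
    simp only [Finset.sum_add_distrib, Finset.sum_sub_distrib, add_mul, mul_add]
    ring
  -- The coefficients collect to `-1 - 3 = -4` for `da`, to `3 + 3 - 1 - 1 = 4` for `Γ a`, and to
  -- `-3 + 1 = -2` for `a a`. The terms `Bᵏ Γˡₖₗ` cancel between `s1` and `s3`.
  rw [split, s1, s2, s3, s4, s6, s7, s8]
  simp only [mul_sub, Finset.sum_sub_distrib]
  ring

end ConformalAlgebra
end
end ShapeDynamics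

namespace ShapeDynamics
noncomputable section

open Filter

/-! ### Smoothness of matrix operations -/

section MatrixSmooth

variable {E : Type*} [NormedAddCommGroup E] [NormedSpace ℝ E] {ι : Type*} [Fintype ι]
  [DecidableEq ι] {A : E → Matrix ι ι ℝ} {p : E}

theorem contDiffAt_matrix_det (hA : ∀ i j, ContDiffAt ℝ ∞ (fun q => A q i j) p) :
    ContDiffAt ℝ ∞ (fun q => (A q).det) p := by
  simp only [Matrix.det_apply]
  refine ContDiffAt.sum fun σ _ => ?_
  exact (contDiffAt_prod fun i _ => hA _ _).const_smul _

/-- Cramer's rule: the entries of the adjugate are determinants of the matrix with one row replaced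
by a constant row. -/
theorem contDiffAt_matrix_inv (hA : ∀ i j, ContDiffAt ℝ ∞ (fun q => A q i j) p)
    (hdet : (A p).det ≠ 0) (i j : ι) : ContDiffAt ℝ ∞ (fun q => (A q)⁻¹ i j) p := by
  have h : (fun q => (A q)⁻¹ i j) = fun q => ((A q).det)⁻¹ * (A q).adjugate i j := by
    funext q
    rw [Matrix.inv_def, Matrix.smul_apply, Ring.inverse_eq_inv', smul_eq_mul]
  rw [h]
  refine ((contDiffAt_matrix_det hA).inv hdet).mul ?_
  simp only [Matrix.adjugate_apply]
  refine contDiffAt_matrix_det fun a b => ?_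
  by_cases hab : a = j
  · subst hab
    simp only [Matrix.updateRow_self]
    exact contDiffAt_const
  · simp only [Matrix.updateRow_ne hab]
    exact hA a b

end MatrixSmooth

/-! ### Partial derivatives -/

section PartialDerivatives

variable {f h : E3 → ℝ} {y : E3} {U : Set E3}

theorem pd_congr (i : Fin 3) (hfh : f =ᶠ[𝓝 y] h) : pd i f y = pd i h y := by
  simp only [pd, hfh.fderiv_eq]

theorem pd_congr_of_isOpen (hU : IsOpen U) (hy : y ∈ U) (i : Fin 3) (hfh : Set.EqOn f h U) :
    pd i f y = pd i h y :=
  pd_congr i (hfh.eventuallyEq_of_mem (hU.mem_nhds hy))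

theorem pd_add (i : Fin 3) (hf : DifferentiableAt ℝ f y) (hh : DifferentiableAt ℝ h y) :
    pd i (fun z => f z + h z) y = pd i f y + pd i h y := by
  simp only [pd, fderiv_fun_add hf hh, add_apply]

theorem pd_sub (i : Fin 3) (hf : DifferentiableAt ℝ f y) (hh : DifferentiableAt ℝ h y) :
    pd i (fun z => f z - h z) y = pd i f y - pd i h y := by
  simp only [pd, fderiv_fun_sub hf hh, sub_apply]

theorem pd_mul (i : Fin 3) (hf : DifferentiableAt ℝ f y) (hh : DifferentiableAt ℝ h y) :
    pd i (fun z => f z * h z) y = pd i f y * h y + f y * pd i h y := by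
  simp only [pd, fderiv_fun_mul hf hh, add_apply,
    smul_apply, smul_eq_mul]
  ring

theorem pd_const_mul (i : Fin 3) (c : ℝ) (f : E3 → ℝ) (y : E3) :
    pd i (fun z => c * f z) y = c * pd i f y := by
  simp only [pd]
  rw [show (fun z => c * f z) = c • f from rfl, fderiv_const_smul_field]
  rfl

theorem pd_const (i : Fin 3) (c : ℝ) (y : E3) : pd i (fun _ => c) y = 0 := by
  simp [pd]

theorem pd_sum {ι : Type*} (s : Finset ι) (i : Fin 3) {F : ι → E3 → ℝ}
    (hF : ∀ a ∈ s, DifferentiableAt ℝ (F a) y) :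
    pd i (fun z => ∑ a ∈ s, F a z) y = ∑ a ∈ s, pd i (F a) y := by
  simp only [pd, fderiv_fun_sum hF, sum_apply]

theorem pd_div (i : Fin 3) (hf : DifferentiableAt ℝ f y) (hh : DifferentiableAt ℝ h y)
    (h0 : h y ≠ 0) :
    pd i (fun z => f z / h z) y = pd i f y / h y - f y * pd i h y / h y ^ 2 := by
  have hq : DifferentiableAt ℝ (fun z => f z / h z) y := by
    simpa only [div_eq_mul_inv] using hf.fun_mul (hh.fun_inv h0)
  have h1 : pd i f y = pd i (fun z => f z / h z * h z) y := by
    refine pd_congr i ?_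
    filter_upwards [hh.continuousAt.eventually_ne h0] with z hz
    rw [div_mul_cancel₀ _ hz]
  rw [pd_mul i hq hh] at h1
  rw [h1]
  field_simp
  ring

theorem pd_rpow (i : Fin 3) (hf : DifferentiableAt ℝ f y) (h0 : f y ≠ 0) (r : ℝ) :
    pd i (fun z => f z ^ r) y = r * f y ^ (r - 1) * pd i f y := by
  simp only [pd]
  rw [(hf.hasFDerivAt.rpow_const (Or.inl h0)).fderiv]
  simp

theorem contDiffOn_pd (hU : IsOpen U) (hf : ContDiffOn ℝ ∞ f U) (i : Fin 3) :
    ContDiffOn ℝ ∞ (pd i f) U :=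
  (hf.fderiv_of_isOpen hU (by simp)).clm_apply contDiffOn_const

theorem ContDiffOn.differentiableAt_of_isOpen (hf : ContDiffOn ℝ ∞ f U) (hU : IsOpen U)
    (hy : y ∈ U) : DifferentiableAt ℝ f y :=
  (hf.contDiffAt (hU.mem_nhds hy)).differentiableAt (by simp)

end PartialDerivatives

/-! ### Curvature in terms of the two-jet of the metric -/

/-- Derivatives of the Christoffel symbols in terms of the two-jet of the metric. -/
def christoffelDerivOf (gi : Fin 3 → Fin 3 → ℝ) (dg : Fin 3 → Fin 3 → Fin 3 → ℝ)
    (ddg : Fin 3 → Fin 3 → Fin 3 → Fin 3 → ℝ) (m k i j : Fin 3) : ℝ :=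
  (1 / 2) * ∑ l, ((-∑ c, ∑ b, gi k c * dg m c b * gi b l) * (dg i j l + dg j i l - dg l i j) +
    gi k l * (ddg m i j l + ddg m j i l - ddg m l i j))

section LocalGeometry

variable {G : E3 → Mat3} {U : Set E3} {y : E3} {W u v : E3 → ℝ}

theorem contDiffOn_inv (hU : IsOpen U) (hG : ∀ i j, ContDiffOn ℝ ∞ (fun z => G z i j) U)
    (hdet : ∀ z ∈ U, (G z).det ≠ 0) (i j : Fin 3) : ContDiffOn ℝ ∞ (fun z => (G z)⁻¹ i j) U :=
  fun z hz => (contDiffAt_matrix_inv (fun a b => (hG a b).contDiffAt (hU.mem_nhds hz))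
    (hdet z hz) i j).contDiffWithinAt

/-- Obtained by differentiating `G⁻¹ G = 1`, which holds on the whole open set `U`. -/
theorem pd_inv (hU : IsOpen U) (hG : ∀ i j, ContDiffOn ℝ ∞ (fun z => G z i j) U)
    (hdet : ∀ z ∈ U, (G z).det ≠ 0) (hy : y ∈ U) (m k l : Fin 3) :
    pd m (fun z => (G z)⁻¹ k l) y =
      -∑ c, ∑ b, (G y)⁻¹ k c * pd m (fun z => G z c b) y * (G y)⁻¹ b l := by
  have hi := contDiffOn_inv hU hG hdet
  have hdG : ∀ i j, DifferentiableAt ℝ (fun z => G z i j) y :=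
    fun i j => ContDiffOn.differentiableAt_of_isOpen (hG i j) hU hy
  have hdi : ∀ i j, DifferentiableAt ℝ (fun z => (G z)⁻¹ i j) y :=
    fun i j => ContDiffOn.differentiableAt_of_isOpen (hi i j) hU hy
  let D : Mat3 := Matrix.of fun i j => pd m (fun z => G z i j) y
  let D' : Mat3 := Matrix.of fun i j => pd m (fun z => (G z)⁻¹ i j) y
  have hprod : D' * G y + (G y)⁻¹ * D = 0 := by
    ext i j
    have h1 : pd m (fun z => ∑ b, (G z)⁻¹ i b * G z b j) y = 0 := by
      rw [pd_congr_of_isOpen hU hy m (h := fun _ => (1 : Mat3) i j), pd_const]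
      intro z hz
      have := congrFun (congrFun (Matrix.nonsing_inv_mul (G z) (hdet z hz).isUnit) i) j
      simpa [Matrix.mul_apply] using this
    rw [pd_sum _ _ fun b _ => (hdi i b).fun_mul (hdG b j)] at h1
    simp only [pd_mul m (hdi i _) (hdG _ j)] at h1
    simpa [Matrix.mul_apply, D, D', Finset.sum_add_distrib] using h1
  have hD : D' = -((G y)⁻¹ * D * (G y)⁻¹) := by
    have h2 : D' * G y * (G y)⁻¹ = -((G y)⁻¹ * D) * (G y)⁻¹ := by
      rw [eq_neg_of_add_eq_zero_left hprod]
    rw [Matrix.mul_nonsing_inv_cancel_right _ _ (hdet y hy).isUnit] at h2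
    rw [h2, Matrix.neg_mul]
  have := congrFun (congrFun hD k) l
  simp only [D, D', Matrix.of_apply, Matrix.neg_apply, Matrix.mul_apply, Finset.sum_mul] at this
  rw [this, Finset.sum_comm]

theorem christoffel_eq (G : E3 → Mat3) (y : E3) (k i j : Fin 3) :
    christoffel G k i j y =
      christoffelOf (fun i j => (G y)⁻¹ i j) (fun m i j => pd m (fun z => G z i j) y) k i j := rfl

theorem contDiffOn_christoffel (hU : IsOpen U) (hG : ∀ i j, ContDiffOn ℝ ∞ (fun z => G z i j) U)
    (hdet : ∀ z ∈ U, (G z).det ≠ 0) (k i j : Fin 3) : ContDiffOn ℝ ∞ (christoffel G k i j) U := by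
  have hi := contDiffOn_inv hU hG hdet
  refine contDiffOn_const.mul (ContDiffOn.sum fun l _ => (hi k l).mul ?_)
  exact ((contDiffOn_pd hU (hG j l) i).add (contDiffOn_pd hU (hG i l) j)).sub
    (contDiffOn_pd hU (hG i j) l)

theorem pd_christoffel (hU : IsOpen U) (hG : ∀ i j, ContDiffOn ℝ ∞ (fun z => G z i j) U)
    (hdet : ∀ z ∈ U, (G z).det ≠ 0) (hy : y ∈ U) (m k i j : Fin 3) :
    pd m (christoffel G k i j) y =
      christoffelDerivOf (fun i j => (G y)⁻¹ i j) (fun m i j => pd m (fun z => G z i j) y)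
        (fun m n i j => pd m (pd n fun z => G z i j) y) m k i j := by
  have hi := contDiffOn_inv hU hG hdet
  have hdi : ∀ i j, DifferentiableAt ℝ (fun z => (G z)⁻¹ i j) y :=
    fun i j => ContDiffOn.differentiableAt_of_isOpen (hi i j) hU hy
  have hp : ∀ n i j, DifferentiableAt ℝ (pd n fun z => G z i j) y :=
    fun n i j => ContDiffOn.differentiableAt_of_isOpen (contDiffOn_pd hU (hG i j) n) hU hy
  have hs : ∀ l, DifferentiableAt ℝ (fun z => pd i (fun z => G z j l) z + pd j (fun z => G z i l) z
      - pd l (fun z => G z i j) z) y := fun l => ((hp i j l).fun_add (hp j i l)).fun_sub (hp l i j)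
  unfold christoffel
  rw [pd_const_mul, pd_sum _ _ fun l _ => (hdi k l).fun_mul (hs l), christoffelDerivOf]
  congr 1
  refine Finset.sum_congr rfl fun l _ => ?_
  rw [pd_mul m (hdi k l) (hs l), pd_inv hU hG hdet hy,
    pd_sub m ((hp i j l).fun_add (hp j i l)) (hp l i j), pd_add m (hp i j l) (hp j i l)]

theorem coordScalarCurvature_eq (hU : IsOpen U)
    (hG : ∀ i j, ContDiffOn ℝ ∞ (fun z => G z i j) U)
    (hdet : ∀ z ∈ U, (G z).det ≠ 0) (hy : y ∈ U) :
    coordScalarCurvature G y =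
      curvatureContraction (fun i j => (G y)⁻¹ i j)
        (christoffelOf (fun i j => (G y)⁻¹ i j) (fun m i j => pd m (fun z => G z i j) y))
        (christoffelDerivOf (fun i j => (G y)⁻¹ i j) (fun m i j => pd m (fun z => G z i j) y)
          (fun m n i j => pd m (pd n fun z => G z i j) y)) := by
  simp only [coordScalarCurvature, curvatureContraction, pd_christoffel hU hG hdet hy,
    christoffel_eq]

end LocalGeometry
end
end ShapeDynamics

namespace ShapeDynamics
noncomputable section

/-! ### Conformal changes of a coordinate metric -/

section Conformal

variable {G : E3 → Mat3} {U : Set E3} {y : E3} {W u v : E3 → ℝ}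

theorem kron_eq_mul_inv {A : Mat3} (hA : A.det ≠ 0) (i k : Fin 3) :
    ∑ j, A i j * A⁻¹ j k = kron i k := by
  have := congrFun (congrFun (Matrix.mul_nonsing_inv A hA.isUnit) i) k
  simpa [Matrix.mul_apply, Matrix.one_apply] using this

theorem inv_symm_apply {A : Mat3} (hA : A.IsSymm) (i j : Fin 3) : A⁻¹ i j = A⁻¹ j i := by
  have h : (A⁻¹).transpose = A⁻¹ := by rw [Matrix.transpose_nonsing_inv, hA.eq]
  exact (congrFun (congrFun h j) i)

/-- The logarithmic derivative `∂ᵢ W / (3 W)` of `W ^ (1/3)`. -/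
def logDeriv3 (W : E3 → ℝ) (i : Fin 3) (y : E3) : ℝ := pd i W y / (3 * W y)

theorem contDiffOn_logDeriv3 (hU : IsOpen U) (hW : ContDiffOn ℝ ∞ W U) (hpos : ∀ z ∈ U, 0 < W z)
    (i : Fin 3) : ContDiffOn ℝ ∞ (logDeriv3 W i) U :=
  (contDiffOn_pd hU hW i).div (contDiffOn_const.mul hW) fun z hz =>
    (mul_pos three_pos (hpos z hz)).ne'

theorem pd_logDeriv3 (hU : IsOpen U) (hW : ContDiffOn ℝ ∞ W U) (hpos : ∀ z ∈ U, 0 < W z)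
    (hy : y ∈ U) (m i : Fin 3) :
    pd m (logDeriv3 W i) y =
      pd m (pd i W) y / (3 * W y) - pd i W y * pd m W y / (3 * W y ^ 2) := by
  have hd : DifferentiableAt ℝ W y := ContDiffOn.differentiableAt_of_isOpen hW hU hy
  have h0 := (hpos y hy).ne'
  unfold logDeriv3
  rw [pd_div m (ContDiffOn.differentiableAt_of_isOpen (contDiffOn_pd hU hW i) hU hy)
    (hd.const_mul 3) (mul_ne_zero three_ne_zero h0), pd_const_mul]
  field_simp

theorem inv_rpow_smul (w : ℝ) (A : Mat3) (hw : 0 < w) (hA : A.det ≠ 0) (r : ℝ) :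
    (w ^ r • A)⁻¹ = (w ^ r)⁻¹ • A⁻¹ := by
  have h := (Real.rpow_pos_of_pos hw r).ne'
  let _ := invertibleOfNonzero h
  rw [Matrix.inv_smul _ _ hA.isUnit, invOf_eq_inv]

theorem pd_conformal (hU : IsOpen U) (hG : ∀ i j, ContDiffOn ℝ ∞ (fun z => G z i j) U)
    (hW : ContDiffOn ℝ ∞ W U) (hpos : ∀ z ∈ U, 0 < W z) (hy : y ∈ U) (m i j : Fin 3) :
    pd m (fun z => W z ^ (2 / 3 : ℝ) * G z i j) y =
      W y ^ (2 / 3 : ℝ) * (2 * logDeriv3 W m y * G y i j + pd m (fun z => G z i j) y) := by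
  have hd : DifferentiableAt ℝ W y := ContDiffOn.differentiableAt_of_isOpen hW hU hy
  have h0 := hpos y hy
  rw [pd_mul m (hd.rpow_const (Or.inl h0.ne'))
    (ContDiffOn.differentiableAt_of_isOpen (hG i j) hU hy), pd_rpow m hd h0.ne',
    Real.rpow_sub_one h0.ne', logDeriv3]
  field_simp

/-- The gradient vector field of `log (W ^ (1/3))`. -/
def logGrad3 (G : E3 → Mat3) (W : E3 → ℝ) (k : Fin 3) (y : E3) : ℝ :=
  ∑ l, (G y)⁻¹ k l * logDeriv3 W l y

theorem christoffel_conformal (hU : IsOpen U)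
    (hG : ∀ i j, ContDiffOn ℝ ∞ (fun z => G z i j) U) (hsymm : ∀ z ∈ U, (G z).IsSymm)
    (hdet : ∀ z ∈ U, (G z).det ≠ 0)
    (hW : ContDiffOn ℝ ∞ W U) (hpos : ∀ z ∈ U, 0 < W z) (hy : y ∈ U) (k i j : Fin 3) :
    christoffel (fun z => W z ^ (2 / 3 : ℝ) • G z) k i j y =
      christoffel G k i j y +
        connDiff (fun i j => G y i j) (fun i => logDeriv3 W i y) (fun k => logGrad3 G W k y)
          k i j := by
  have h0 := (Real.rpow_pos_of_pos (hpos y hy) (2 / 3)).ne'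
  -- The Kronecker symbols of `connDiff` are rewritten as contractions of `G` with its inverse, so
  -- that both sides become sums over the same index `l` and can be compared termwise.
  have hinv : ∀ a, ∑ l, (G y)⁻¹ k l * G y a l = kron k a := by
    intro a
    have := congrFun (congrFun (Matrix.nonsing_inv_mul (G y) (hdet y hy).isUnit) k) a
    simpa [Matrix.mul_apply, Matrix.one_apply, (hsymm y hy).apply] using this
  simp only [christoffel, pd_conformal hU hG hW hpos hy,
    inv_rpow_smul _ _ (hpos y hy) (hdet y hy), Matrix.smul_apply, smul_eq_mul, connDiff,
    logGrad3, ← hinv]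
  simp only [Finset.mul_sum, Finset.sum_mul, ← Finset.sum_add_distrib, ← Finset.sum_sub_distrib]
  refine Finset.sum_congr rfl fun l _ => ?_
  field_simp
  ring

theorem pd_connDiff (hU : IsOpen U)
    (hG : ∀ i j, ContDiffOn ℝ ∞ (fun z => G z i j) U)
    (hdet : ∀ z ∈ U, (G z).det ≠ 0)
    (hW : ContDiffOn ℝ ∞ W U) (hpos : ∀ z ∈ U, 0 < W z) (hy : y ∈ U) (m k i j : Fin 3) :
    pd m (fun z => connDiff (fun i j => G z i j) (fun i => logDeriv3 W i z)
        (fun k => logGrad3 G W k z) k i j) y =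
      connDiffDeriv (fun i j => G y i j) (fun m i j => pd m (fun z => G z i j) y)
        (fun k => logGrad3 G W k y) (fun m i => pd m (logDeriv3 W i) y)
        (fun m k => pd m (logGrad3 G W k) y) m k i j := by
  have hi := contDiffOn_inv hU hG hdet
  have ha := contDiffOn_logDeriv3 hU hW hpos
  have hda : ∀ i, DifferentiableAt ℝ (logDeriv3 W i) y := fun i =>
    ContDiffOn.differentiableAt_of_isOpen (ha i) hU hy
  have hdB : DifferentiableAt ℝ (logGrad3 G W k) y :=
    ContDiffOn.differentiableAt_of_isOpen (ContDiffOn.sum fun l _ => (hi k l).mul (ha l)) hU hy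
  have hdG := ContDiffOn.differentiableAt_of_isOpen (hG i j) hU hy
  simp only [connDiff, connDiffDeriv]
  rw [pd_sub m (((hda j).const_mul _).fun_add ((hda i).const_mul _)) (hdG.fun_mul hdB),
    pd_add m ((hda j).const_mul _) ((hda i).const_mul _), pd_const_mul, pd_const_mul,
    pd_mul m hdG hdB]

theorem pd_logGrad3 (hU : IsOpen U)
    (hG : ∀ i j, ContDiffOn ℝ ∞ (fun z => G z i j) U)
    (hdet : ∀ z ∈ U, (G z).det ≠ 0)
    (hW : ContDiffOn ℝ ∞ W U) (hpos : ∀ z ∈ U, 0 < W z) (hy : y ∈ U) (m k : Fin 3) :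
    pd m (logGrad3 G W k) y =
      ∑ l, ((-∑ c, ∑ b, (G y)⁻¹ k c * pd m (fun z => G z c b) y * (G y)⁻¹ b l) * logDeriv3 W l y
        + (G y)⁻¹ k l * pd m (logDeriv3 W l) y) := by
  have hdi : ∀ i j, DifferentiableAt ℝ (fun z => (G z)⁻¹ i j) y :=
    fun i j => ContDiffOn.differentiableAt_of_isOpen (contDiffOn_inv hU hG hdet i j) hU hy
  have hda : ∀ i, DifferentiableAt ℝ (logDeriv3 W i) y := fun i =>
    ContDiffOn.differentiableAt_of_isOpen (contDiffOn_logDeriv3 hU hW hpos i) hU hy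
  unfold logGrad3
  rw [pd_sum _ _ fun l _ => (hdi k l).fun_mul (hda l)]
  refine Finset.sum_congr rfl fun l _ => ?_
  rw [pd_mul m (hdi k l) (hda l), pd_inv hU hG hdet hy]

/-- The connection changes by `connDiff` with `a = d log W^{1/3} = dW / (3W)`. In `-4 ∇·a - 2 |a|²`
the derivative of `1/W` contributes `4/3` and the square contributes `-2/9` to the coefficient of
`|dW|² / W²`, whence `10/9`. -/
theorem coordScalarCurvature_conformal (hU : IsOpen U)
    (hG : ∀ i j, ContDiffOn ℝ ∞ (fun z => G z i j) U) (hsymm : ∀ z ∈ U, (G z).IsSymm)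
    (hdet : ∀ z ∈ U, (G z).det ≠ 0)
    (hW : ContDiffOn ℝ ∞ W U) (hpos : ∀ z ∈ U, 0 < W z) (hy : y ∈ U) :
    coordScalarCurvature (fun z => W z ^ (2 / 3 : ℝ) • G z) y =
      (W y ^ (2 / 3 : ℝ))⁻¹ * (coordScalarCurvature G y - 4 / 3 * coordLaplacian G W y / W y
        + 10 / 9 * (∑ i, ∑ j, (G y)⁻¹ i j * (pd i W y * pd j W y)) / W y ^ 2) := by
  have h0 := (hpos y hy).ne'
  have hsG : ∀ z ∈ U, ∀ i j, G z i j = G z j i := fun z hz i j => ((hsymm z hz).apply i j).symm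
  have key := curvatureContraction_conformal (g := fun i j => G y i j)
    (gi := fun i j => (G y)⁻¹ i j) (dg := fun m i j => pd m (fun z => G z i j) y)
    (a := fun i => logDeriv3 W i y) (B := fun k => logGrad3 G W k y)
    (da := fun m i => pd m (logDeriv3 W i) y) (dB := fun m k => pd m (logGrad3 G W k) y)
    (kron_eq_mul_inv (hdet y hy)) (hsG y hy) (inv_symm_apply (hsymm y hy))
    (fun m i j => pd_congr_of_isOpen hU hy m fun z hz => hsG z hz i j) (fun k => rfl)
    (fun m k => pd_logGrad3 hU hG hdet hW hpos hy m k)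
    (fun m k i j => pd m (christoffel G k i j) y)
  have hΓ := fun k i j => contDiffOn_christoffel hU hG hdet k i j
  have hdconn : ∀ k i j, DifferentiableAt ℝ (fun z => connDiff (fun i j => G z i j)
      (fun i => logDeriv3 W i z) (fun k => logGrad3 G W k z) k i j) y := by
    intro k i j
    have ha := contDiffOn_logDeriv3 hU hW hpos
    have hi := contDiffOn_inv hU hG hdet
    refine ContDiffOn.differentiableAt_of_isOpen (U := U) ?_ hU hy
    exact ((contDiffOn_const.mul (ha j)).add (contDiffOn_const.mul (ha i))).sub
      ((hG i j).mul (ContDiffOn.sum fun l _ => (hi k l).mul (ha l)))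
  have hpd : ∀ m k i j, pd m (christoffel (fun z => W z ^ (2 / 3 : ℝ) • G z) k i j) y =
      pd m (christoffel G k i j) y +
      connDiffDeriv (fun i j => G y i j) (fun m i j => pd m (fun z => G z i j) y)
        (fun k => logGrad3 G W k y) (fun m i => pd m (logDeriv3 W i) y)
        (fun m k => pd m (logGrad3 G W k) y) m k i j := by
    intro m k i j
    rw [← pd_connDiff hU hG hdet hW hpos hy,
      ← pd_add m (ContDiffOn.differentiableAt_of_isOpen (hΓ k i j) hU hy) (hdconn k i j)]
    exact pd_congr_of_isOpen hU hy m fun z hz =>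
      christoffel_conformal hU hG hsymm hdet hW hpos hz k i j
  have hL : coordScalarCurvature (fun z => W z ^ (2 / 3 : ℝ) • G z) y =
      (W y ^ (2 / 3 : ℝ))⁻¹ * curvatureContraction (fun i j => (G y)⁻¹ i j)
        (fun k i j => christoffelOf (fun i j => (G y)⁻¹ i j)
          (fun m i j => pd m (fun z => G z i j) y) k i j +
          connDiff (fun i j => G y i j) (fun i => logDeriv3 W i y)
            (fun k => logGrad3 G W k y) k i j)
        (fun m k i j => pd m (christoffel G k i j) y +
          connDiffDeriv (fun i j => G y i j) (fun m i j => pd m (fun z => G z i j) y)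
            (fun k => logGrad3 G W k y) (fun m i => pd m (logDeriv3 W i) y)
            (fun m k => pd m (logGrad3 G W k) y) m k i j) := by
    simp only [coordScalarCurvature, curvatureContraction, hpd,
      christoffel_conformal hU hG hsymm hdet hW hpos hy,
      inv_rpow_smul _ _ (hpos y hy) (hdet y hy), Matrix.smul_apply, smul_eq_mul, christoffel_eq,
      Finset.mul_sum (a := (W y ^ (2 / 3 : ℝ))⁻¹), mul_assoc]
  have hR : curvatureContraction (fun i j => (G y)⁻¹ i j)
      (christoffelOf (fun i j => (G y)⁻¹ i j) (fun m i j => pd m (fun z => G z i j) y))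
      (fun m k i j => pd m (christoffel G k i j) y) = coordScalarCurvature G y := rfl
  rw [hL, key, hR]
  congr 1
  simp only [coordLaplacian, Finset.mul_sum (a := (4 / 3 : ℝ)), Finset.mul_sum (a := (4 : ℝ)),
    Finset.mul_sum (a := (2 : ℝ)), Finset.mul_sum (a := (10 / 9 : ℝ)), Finset.sum_div]
  rw [sub_sub, sub_add]
  congr 1
  simp only [← Finset.sum_add_distrib, ← Finset.sum_sub_distrib]
  refine Finset.sum_congr rfl fun i _ => Finset.sum_congr rfl fun j _ => ?_
  have e : ∑ k, christoffelOf (fun i j => (G y)⁻¹ i j) (fun m i j => pd m (fun z => G z i j) y)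
      k i j * logDeriv3 W k y = (∑ k, christoffel G k i j y * pd k W y) / (3 * W y) := by
    simp only [Finset.sum_div, logDeriv3, christoffel_eq, mul_div_assoc]
  rw [e, pd_logDeriv3 hU hW hpos hy]
  simp only [logDeriv3]
  field_simp
  ring

/-- By `connDiff_contract` the trace of the change of connection is `-B`, so the Laplacian gains `Bᵏ
∂ₖ u`, apart from the overall factor from the inverse metric. -/
theorem coordLaplacian_conformal (hU : IsOpen U)
    (hG : ∀ i j, ContDiffOn ℝ ∞ (fun z => G z i j) U) (hsymm : ∀ z ∈ U, (G z).IsSymm)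
    (hdet : ∀ z ∈ U, (G z).det ≠ 0)
    (hW : ContDiffOn ℝ ∞ W U) (hpos : ∀ z ∈ U, 0 < W z) (hy : y ∈ U) (u : E3 → ℝ) :
    coordLaplacian (fun z => W z ^ (2 / 3 : ℝ) • G z) u y =
      (W y ^ (2 / 3 : ℝ))⁻¹ * (coordLaplacian G u y
        + (∑ i, ∑ j, (G y)⁻¹ i j * (pd i W y * pd j u y)) / (3 * W y)) := by
  have hsG : ∀ i j, G y i j = G y j i := fun i j => ((hsymm y hy).apply i j).symm
  have hc := fun k => connDiff_contract (g := fun i j => G y i j)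
    (gi := fun i j => (G y)⁻¹ i j) (a := fun i => logDeriv3 W i y)
    (B := fun k => logGrad3 G W k y)
    (kron_eq_mul_inv (hdet y hy)) (inv_symm_apply (hsymm y hy)) (fun k => rfl) k
  beta_reduce at hc
  have e1 : ∑ i, ∑ j, (G y)⁻¹ i j * ∑ k, connDiff (fun i j => G y i j)
      (fun i => logDeriv3 W i y) (fun k => logGrad3 G W k y) k i j * pd k u y =
      -((∑ i, ∑ j, (G y)⁻¹ i j * (pd i W y * pd j u y)) / (3 * W y)) := by
    have swap : ∀ (T : Fin 3 → Fin 3 → Fin 3 → ℝ) (t : Fin 3 → ℝ),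
        ∑ i, ∑ j, (G y)⁻¹ i j * ∑ k, T k i j * t k =
          ∑ k, (∑ i, ∑ j, (G y)⁻¹ i j * T k i j) * t k := by
      intro T t
      simp only [Fin.sum_univ_three]; ring
    rw [swap]
    simp only [hc]
    simp only [logGrad3, neg_mul, Finset.sum_neg_distrib, Finset.sum_mul, Finset.sum_div]
    rw [Finset.sum_comm]
    refine congrArg _ (Finset.sum_congr rfl fun i _ => Finset.sum_congr rfl fun j _ => ?_)
    rw [inv_symm_apply (hsymm y hy) j i, logDeriv3]
    ring
  have e2 : coordLaplacian (fun z => W z ^ (2 / 3 : ℝ) • G z) u y =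
      (W y ^ (2 / 3 : ℝ))⁻¹ * (coordLaplacian G u y -
        ∑ i, ∑ j, (G y)⁻¹ i j * ∑ k, connDiff (fun i j => G y i j)
          (fun i => logDeriv3 W i y) (fun k => logGrad3 G W k y) k i j * pd k u y) := by
    simp only [coordLaplacian, christoffel_conformal hU hG hsymm hdet hW hpos hy,
      inv_rpow_smul _ _ (hpos y hy) (hdet y hy), Matrix.smul_apply, smul_eq_mul,
      ← Finset.sum_sub_distrib]
    simp only [Finset.mul_sum (a := (W y ^ (2 / 3 : ℝ))⁻¹)]
    refine Finset.sum_congr rfl fun i _ => Finset.sum_congr rfl fun j _ => ?_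
    simp only [add_mul, Finset.sum_add_distrib]
    ring
  rw [e2, e1, sub_neg_eq_add]

theorem coordLaplacian_div (hU : IsOpen U) (hsymm : (G y).IsSymm)
    (hv : ContDiffOn ℝ ∞ v U) (hW : ContDiffOn ℝ ∞ W U) (hpos : ∀ z ∈ U, 0 < W z) (hy : y ∈ U) :
    coordLaplacian G (fun z => v z / W z) y =
      coordLaplacian G v y / W y - v y * coordLaplacian G W y / W y ^ 2
        - 2 * (∑ i, ∑ j, (G y)⁻¹ i j * (pd i W y * pd j v y)) / W y ^ 2
        + 2 * v y * (∑ i, ∑ j, (G y)⁻¹ i j * (pd i W y * pd j W y)) / W y ^ 3 := by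
  have hd : ∀ {f : E3 → ℝ}, ContDiffOn ℝ ∞ f U → ∀ z ∈ U, DifferentiableAt ℝ f z :=
    fun hf z hz => ContDiffOn.differentiableAt_of_isOpen hf hU hz
  have h0 : ∀ z ∈ U, W z ≠ 0 := fun z hz => (hpos z hz).ne'
  have hy0 := h0 y hy
  have h1 : ∀ j, ∀ z ∈ U, pd j (fun z => v z / W z) z =
      pd j v z / W z - v z * pd j W z / W z ^ 2 := fun j z hz =>
    pd_div j (hd hv z hz) (hd hW z hz) (h0 z hz)
  have hpv := fun j => contDiffOn_pd hU hv j
  have hpW := fun j => contDiffOn_pd hU hW j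
  have h2 : ∀ i j, pd i (pd j fun z => v z / W z) y =
      pd i (pd j v) y / W y - pd j v y * pd i W y / W y ^ 2
      - (pd i v y * pd j W y + v y * pd i (pd j W) y) / W y ^ 2
      + 2 * v y * (pd i W y * pd j W y) / W y ^ 3 := by
    intro i j
    have d1 : DifferentiableAt ℝ (fun z => pd j v z / W z) y :=
      hd ((hpv j).div hW h0) y hy
    have d2 : DifferentiableAt ℝ (fun z => v z * pd j W z) y := hd (hv.mul (hpW j)) y hy
    have d3 : DifferentiableAt ℝ (fun z => W z ^ 2) y := hd (hW.pow 2) y hy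
    have d4 : DifferentiableAt ℝ (fun z => v z * pd j W z / W z ^ 2) y :=
      hd ((hv.mul (hpW j)).div (hW.pow 2) fun z hz => pow_ne_zero _ (h0 z hz)) y hy
    rw [pd_congr_of_isOpen hU hy i (h1 j), pd_sub i d1 d4,
      pd_div i (hd (hpv j) y hy) (hd hW y hy) hy0, pd_div i d2 d3 (pow_ne_zero _ hy0),
      pd_mul i (hd hv y hy) (hd (hpW j) y hy)]
    have h3 : pd i (fun z => W z ^ 2) y = 2 * W y * pd i W y := by
      simp only [pow_two]
      rw [pd_mul i (hd hW y hy) (hd hW y hy)]; ring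
    rw [h3]
    field_simp
    ring
  have hswap : ∑ i, ∑ j, (G y)⁻¹ i j * (pd i v y * pd j W y) =
      ∑ i, ∑ j, (G y)⁻¹ i j * (pd i W y * pd j v y) := by
    rw [Finset.sum_comm]
    refine Finset.sum_congr rfl fun i _ => Finset.sum_congr rfl fun j _ => ?_
    rw [inv_symm_apply hsymm j i]; ring
  have e : coordLaplacian G (fun z => v z / W z) y =
      coordLaplacian G v y / W y - v y * coordLaplacian G W y / W y ^ 2
        - (∑ i, ∑ j, (G y)⁻¹ i j * (pd i W y * pd j v y)) / W y ^ 2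
        - (∑ i, ∑ j, (G y)⁻¹ i j * (pd i v y * pd j W y)) / W y ^ 2
        + 2 * v y * (∑ i, ∑ j, (G y)⁻¹ i j * (pd i W y * pd j W y)) / W y ^ 3 := by
    simp only [coordLaplacian, h2, h1 _ y hy, Finset.mul_sum (a := v y),
      Finset.mul_sum (a := 2 * v y), Finset.sum_div, ← Finset.sum_sub_distrib,
      ← Finset.sum_add_distrib]
    refine Finset.sum_congr rfl fun i _ => Finset.sum_congr rfl fun j _ => ?_
    simp only [Fin.sum_univ_three]
    field_simp
    ring
  rw [e, hswap]
  ring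

end Conformal
end
end ShapeDynamics

namespace ShapeDynamics
noncomputable section

/-! ### The transformed constraint as a function of finitely many jet components -/

/-- Labels of the components of the two-jets of the metric and of `Ω⁶`, of the momentum at a point,
and of the two integrals `∫ π` and `∫ √g`. -/
inductive JetIndex : Type
  | metric (i j : Fin 3)
  | metricDeriv (m i j : Fin 3)
  | metricDeriv₂ (m n i j : Fin 3)
  | momentum (i j : Fin 3)
  | momentumIntegral
  | volume
  | factor
  | factorDeriv (i : Fin 3)
  | factorDeriv₂ (i j : Fin 3)
  deriving Fintype

open JetIndex

/-- The kinetic part of the transformed constraint, as a function of `w = Ω⁶` and of the mean `μ`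
of the trace of the momentum. -/
def kineticTerm (G P : Mat3) (μ w : ℝ) : ℝ :=
  let Q : Mat3 := P - ((1 / 3) * μ * (1 - w) * Real.sqrt G.det) • G⁻¹
  ((∑ a, ∑ b, ∑ c, ∑ d, G a c * G b d * Q a b * Q c d) - (∑ a, ∑ b, Q a b * G a b) ^ 2 / 2)
    / (w ^ 2 * G.det)

/-- The metric components of a jet. -/
def jetMetric (c : JetIndex → ℝ) : Mat3 := Matrix.of fun i j => c (metric i j)

/-- The momentum components of a jet. -/
def jetMomentum (c : JetIndex → ℝ) : Mat3 := Matrix.of fun i j => c (momentum i j)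

/-- The Christoffel symbols of a jet. -/
def jetChristoffel (c : JetIndex → ℝ) (k i j : Fin 3) : ℝ :=
  christoffelOf (fun i j => (jetMetric c)⁻¹ i j) (fun m i j => c (metricDeriv m i j)) k i j

/-- The scalar curvature of a jet. -/
def jetCurvature (c : JetIndex → ℝ) : ℝ :=
  curvatureContraction (fun i j => (jetMetric c)⁻¹ i j) (jetChristoffel c)
    (christoffelDerivOf (fun i j => (jetMetric c)⁻¹ i j) (fun m i j => c (metricDeriv m i j))
      (fun m n i j => c (metricDeriv₂ m n i j)))

/-- The Laplacian, for the metric of the jet `c`, of the conformal factor of the jet `c'`. -/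
def jetLaplacian (c c' : JetIndex → ℝ) : ℝ :=
  ∑ i, ∑ j, (jetMetric c)⁻¹ i j *
    (c' (factorDeriv₂ i j) - ∑ k, jetChristoffel c k i j * c' (factorDeriv k))

/-- The inner product, for the metric of the jet `c`, of the gradients of two conformal factors. -/
def jetGradInner (c c₁ c₂ : JetIndex → ℝ) : ℝ :=
  ∑ i, ∑ j, (jetMetric c)⁻¹ i j * (c₁ (factorDeriv i) * c₂ (factorDeriv j))

/-- The scalar curvature of `w ^ (2/3) g` in terms of a jet. -/
def jetConformalCurvature (c : JetIndex → ℝ) : ℝ :=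
  (c factor ^ (2 / 3 : ℝ))⁻¹ * (jetCurvature c - 4 / 3 * jetLaplacian c c / c factor
    + 10 / 9 * jetGradInner c c c / c factor ^ 2)

/-- The transformed scalar constraint for `Λ = 0` in terms of a jet. -/
def jetConstraint (c : JetIndex → ℝ) : ℝ :=
  kineticTerm (jetMetric c) (jetMomentum c) (c momentumIntegral / c volume) (c factor)
    - jetConformalCurvature c

section Smoothness

variable {E : Type*} [NormedAddCommGroup E] [NormedSpace ℝ E] {p : E}

theorem contDiffAt_christoffelOf {gi : E → Fin 3 → Fin 3 → ℝ}
    {dg : E → Fin 3 → Fin 3 → Fin 3 → ℝ}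
    (hgi : ∀ i j, ContDiffAt ℝ ∞ (fun q => gi q i j) p)
    (hdg : ∀ m i j, ContDiffAt ℝ ∞ (fun q => dg q m i j) p) (k i j : Fin 3) :
    ContDiffAt ℝ ∞ (fun q => christoffelOf (gi q) (dg q) k i j) p :=
  contDiffAt_const.mul (ContDiffAt.sum fun l _ => (hgi k l).mul
    (((hdg i j l).add (hdg j i l)).sub (hdg l i j)))

theorem contDiffAt_christoffelDerivOf {gi : E → Fin 3 → Fin 3 → ℝ}
    {dg : E → Fin 3 → Fin 3 → Fin 3 → ℝ} {ddg : E → Fin 3 → Fin 3 → Fin 3 → Fin 3 → ℝ}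
    (hgi : ∀ i j, ContDiffAt ℝ ∞ (fun q => gi q i j) p)
    (hdg : ∀ m i j, ContDiffAt ℝ ∞ (fun q => dg q m i j) p)
    (hddg : ∀ m n i j, ContDiffAt ℝ ∞ (fun q => ddg q m n i j) p) (m k i j : Fin 3) :
    ContDiffAt ℝ ∞ (fun q => christoffelDerivOf (gi q) (dg q) (ddg q) m k i j) p :=
  contDiffAt_const.mul (ContDiffAt.sum fun l _ =>
    ((ContDiffAt.sum fun c _ => ContDiffAt.sum fun b _ =>
      ((hgi k c).mul (hdg m c b)).mul (hgi b l)).neg.mul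
        (((hdg i j l).add (hdg j i l)).sub (hdg l i j))).add
    ((hgi k l).mul (((hddg m i j l).add (hddg m j i l)).sub (hddg m l i j))))

theorem contDiffAt_curvatureContraction {gi : E → Fin 3 → Fin 3 → ℝ}
    {Γ : E → Fin 3 → Fin 3 → Fin 3 → ℝ} {dΓ : E → Fin 3 → Fin 3 → Fin 3 → Fin 3 → ℝ}
    (hgi : ∀ i j, ContDiffAt ℝ ∞ (fun q => gi q i j) p)
    (hΓ : ∀ k i j, ContDiffAt ℝ ∞ (fun q => Γ q k i j) p)
    (hdΓ : ∀ m k i j, ContDiffAt ℝ ∞ (fun q => dΓ q m k i j) p) :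
    ContDiffAt ℝ ∞ (fun q => curvatureContraction (gi q) (Γ q) (dΓ q)) p :=
  ContDiffAt.sum fun i _ => ContDiffAt.sum fun j _ => (hgi i j).mul
    ((ContDiffAt.sum fun k _ => (hdΓ k k i j).sub (hdΓ j k i k)).add
    (ContDiffAt.sum fun k _ => ContDiffAt.sum fun l _ =>
      ((hΓ k i j).mul (hΓ l k l)).sub ((hΓ k i l).mul (hΓ l j k))))

theorem contDiffAt_kineticTerm {G P : E → Mat3} {μ w : E → ℝ}
    (hG : ∀ i j, ContDiffAt ℝ ∞ (fun q => G q i j) p)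
    (hP : ∀ i j, ContDiffAt ℝ ∞ (fun q => P q i j) p)
    (hμ : ContDiffAt ℝ ∞ μ p) (hw : ContDiffAt ℝ ∞ w p) (hdet : (G p).det ≠ 0) (hw0 : w p ≠ 0) :
    ContDiffAt ℝ ∞ (fun q => kineticTerm (G q) (P q) (μ q) (w q)) p := by
  have hQ : ∀ i j, ContDiffAt ℝ ∞ (fun q => (P q - ((1 / 3) * μ q * (1 - w q) *
      Real.sqrt (G q).det) • (G q)⁻¹) i j) p := fun i j =>
    (hP i j).sub ((((contDiffAt_const.mul hμ).mul (contDiffAt_const.sub hw)).mul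
      ((contDiffAt_matrix_det hG).sqrt hdet)).mul (contDiffAt_matrix_inv hG hdet i j))
  refine ContDiffAt.div (ContDiffAt.sub ?_ ?_) ((hw.pow 2).mul (contDiffAt_matrix_det hG))
    (mul_ne_zero (pow_ne_zero _ hw0) hdet)
  · exact ContDiffAt.sum fun a _ => ContDiffAt.sum fun b _ => ContDiffAt.sum fun c _ =>
      ContDiffAt.sum fun d _ => (((hG a c).mul (hG b d)).mul (hQ a b)).mul (hQ c d)
  · exact ((ContDiffAt.sum fun a _ => ContDiffAt.sum fun b _ =>
      (hQ a b).mul (hG a b)).pow 2).div_const _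

end Smoothness

/-- Singularities can come only from the inverse and the square root of the determinant, from powers
of the conformal factor, and from the quotient of the integrals. The three hypotheses exclude them.
-/
theorem contDiffAt_jetConstraint {c : JetIndex → ℝ} (hdet : (jetMetric c).det ≠ 0)
    (hw : 0 < c factor) (hV : c volume ≠ 0) : ContDiffAt ℝ ∞ jetConstraint c := by
  have hc : ∀ i : JetIndex, ContDiffAt ℝ ∞ (fun q : JetIndex → ℝ => q i) c :=
    fun i => (contDiff_apply ℝ ℝ i).contDiffAt
  have hG : ∀ i j, ContDiffAt ℝ ∞ (fun q => jetMetric q i j) c := fun i j => hc (metric i j)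
  have hgi := contDiffAt_matrix_inv hG hdet
  have hΓ : ∀ k i j, ContDiffAt ℝ ∞ (fun q => jetChristoffel q k i j) c :=
    contDiffAt_christoffelOf hgi fun m i j => hc _
  have hw0 := hw.ne'
  refine ContDiffAt.sub (contDiffAt_kineticTerm hG (fun i j => hc (momentum i j))
    ((hc _).div (hc _) hV) (hc _) hdet hw0) ?_
  refine ContDiffAt.mul (((hc factor).rpow_const_of_ne hw0).inv
    (Real.rpow_pos_of_pos hw _).ne') (ContDiffAt.add (ContDiffAt.sub ?_ ?_) ?_)
  · exact contDiffAt_curvatureContraction hgi hΓ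
      (contDiffAt_christoffelDerivOf hgi (fun m i j => hc _) fun m n i j => hc _)
  · refine (contDiffAt_const.mul ?_).div (hc _) hw0
    exact ContDiffAt.sum fun i _ => ContDiffAt.sum fun j _ => (hgi i j).mul
      ((hc _).sub (ContDiffAt.sum fun k _ => (hΓ k i j).mul (hc _)))
  · refine (contDiffAt_const.mul ?_).div ((hc _).pow 2) (pow_ne_zero _ hw0)
    exact ContDiffAt.sum fun i _ => ContDiffAt.sum fun j _ => (hgi i j).mul ((hc _).mul (hc _))

/-- The derivative of the transformed constraint in a direction that changes only the jet of the
conformal factor. -/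
theorem fderiv_jetConstraint_factor {c K : JetIndex → ℝ} (hdet : (jetMetric c).det ≠ 0)
    (hsymm : (jetMetric c).IsSymm)
    (hw : 0 < c factor) (hV : c volume ≠ 0) (hK0 : ∀ i j, K (metric i j) = 0)
    (hK1 : ∀ m i j, K (metricDeriv m i j) = 0) (hK2 : ∀ m n i j, K (metricDeriv₂ m n i j) = 0)
    (hKp : ∀ i j, K (momentum i j) = 0) (hKN : K momentumIntegral = 0) (hKV : K volume = 0) :
    fderiv ℝ jetConstraint c K =
      deriv (kineticTerm (jetMetric c) (jetMomentum c) (c momentumIntegral / c volume)) (c factor)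
          * K factor
        + 2 / 3 * (K factor / c factor) * jetConformalCurvature c
        + (c factor ^ (2 / 3 : ℝ))⁻¹ * (4 / 3 * jetLaplacian c K / c factor
          - 4 / 3 * jetLaplacian c c * K factor / c factor ^ 2
          - 20 / 9 * jetGradInner c c K / c factor ^ 2
          + 20 / 9 * jetGradInner c c c * K factor / c factor ^ 3) := by
  set w := c factor with hwdef
  set v := K factor with hvdef
  have hw0 : w ≠ 0 := hw.ne'
  have hF : HasFDerivAt jetConstraint (fderiv ℝ jetConstraint c) c :=
    ((contDiffAt_jetConstraint hdet hw hV).differentiableAt (by simp)).hasFDerivAt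
  -- The directional derivative is taken along the line `c + t • K`. As `K` moves only the jet of
  -- the factor, the metric data and the momentum stay fixed, the Laplacian is affine in `t`, and
  -- the gradient square is quadratic in `t`.
  have hline : HasDerivAt (fun t : ℝ => c + t • K) K 0 := by
    simpa using ((hasDerivAt_id (0 : ℝ)).smul_const K).const_add c
  have h1 : HasDerivAt (fun t : ℝ => jetConstraint (c + t • K)) (fderiv ℝ jetConstraint c K) 0 := by
    have hF0 : HasFDerivAt jetConstraint (fderiv ℝ jetConstraint c) (c + (0 : ℝ) • K) := by
      simpa using hF
    exact hF0.comp_hasDerivAt (0 : ℝ) hline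
  have eM : ∀ t : ℝ, jetMetric (c + t • K) = jetMetric c := fun t => by
    ext i j; simp [jetMetric, hK0]
  have eP : ∀ t : ℝ, jetMomentum (c + t • K) = jetMomentum c := fun t => by
    ext i j; simp [jetMomentum, hKp]
  have eΓ : ∀ t : ℝ, jetChristoffel (c + t • K) = jetChristoffel c := fun t => by
    funext k i j; simp [jetChristoffel, eM, hK1]
  have eR : ∀ t : ℝ, jetCurvature (c + t • K) = jetCurvature c := fun t => by
    simp [jetCurvature, eM, eΓ, hK1, hK2]
  have eL : ∀ t : ℝ, jetLaplacian (c + t • K) (c + t • K) =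
      jetLaplacian c c + t * jetLaplacian c K := fun t => by
    simp only [jetLaplacian, eM, eΓ, Finset.mul_sum (a := t), ← Finset.sum_add_distrib]
    refine Finset.sum_congr rfl fun i _ => Finset.sum_congr rfl fun j _ => ?_
    simp only [Pi.add_apply, Pi.smul_apply, smul_eq_mul, Fin.sum_univ_three]
    ring
  have eQ : ∀ t : ℝ, jetGradInner (c + t • K) (c + t • K) (c + t • K) =
      jetGradInner c c c + 2 * t * jetGradInner c c K + t ^ 2 * jetGradInner c K K := fun t => by
    have hs := inv_symm_apply hsymm
    simp only [jetGradInner, eM, Pi.add_apply, Pi.smul_apply, smul_eq_mul, Fin.sum_univ_three,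
      hs 1 0, hs 2 0, hs 2 1]
    ring
  have eF : ∀ t : ℝ, jetConstraint (c + t • K) =
      kineticTerm (jetMetric c) (jetMomentum c) (c momentumIntegral / c volume) (w + t * v) -
      ((w + t * v) ^ (2 / 3 : ℝ))⁻¹ * (jetCurvature c
        - 4 / 3 * (jetLaplacian c c + t * jetLaplacian c K) / (w + t * v)
        + 10 / 9 * (jetGradInner c c c + 2 * t * jetGradInner c c K + t ^ 2 * jetGradInner c K K)
          / (w + t * v) ^ 2) := fun t => by
    rw [jetConstraint, jetConformalCurvature, eL, eQ, eR, eM, eP]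
    simp [hKN, hKV, hwdef, hvdef]
  have hwt : HasDerivAt (fun t : ℝ => w + t * v) v 0 := by
    simpa using ((hasDerivAt_id (0 : ℝ)).mul_const v).const_add w
  have hkin : HasDerivAt (fun t : ℝ => kineticTerm (jetMetric c) (jetMomentum c)
      (c momentumIntegral / c volume) (w + t * v))
      (deriv (kineticTerm (jetMetric c) (jetMomentum c) (c momentumIntegral / c volume)) w * v)
      0 := by
    have : DifferentiableAt ℝ (kineticTerm (jetMetric c) (jetMomentum c)
        (c momentumIntegral / c volume)) w :=
      (contDiffAt_kineticTerm (G := fun _ => jetMetric c) (P := fun _ => jetMomentum c)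
        (μ := fun _ => c momentumIntegral / c volume) (w := fun t : ℝ => t) (p := w)
        (fun _ _ => contDiffAt_const) (fun _ _ => contDiffAt_const) contDiffAt_const contDiffAt_id
        hdet hw0).differentiableAt (by simp)
    have h0 := this.hasDerivAt
    rw [show w = w + 0 * v by ring] at h0
    have h5 := h0.comp (0 : ℝ) hwt
    rw [show w + 0 * v = w by ring] at h5
    exact h5
  have hrp : HasDerivAt (fun t : ℝ => ((w + t * v) ^ (2 / 3 : ℝ))⁻¹)
      (-(2 / 3) * (v / w) * (w ^ (2 / 3 : ℝ))⁻¹) 0 := by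
    have h2 := (hwt.rpow_const (p := 2 / 3) (Or.inl (by simpa using hw0))).inv
      (by simpa using (Real.rpow_pos_of_pos hw (2 / 3)).ne')
    refine h2.congr_deriv ?_
    have := (Real.rpow_pos_of_pos hw (2 / 3)).ne'
    simp only [zero_mul, add_zero, Real.rpow_sub_one hw0]
    field_simp
  have hLt : HasDerivAt (fun t : ℝ => 4 / 3 * (jetLaplacian c c + t * jetLaplacian c K)
      / (w + t * v)) (4 / 3 * jetLaplacian c K / w - 4 / 3 * jetLaplacian c c * v / w ^ 2) 0 := by
    have h2 := ((((hasDerivAt_id (0 : ℝ)).mul_const (jetLaplacian c K)).const_add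
      (jetLaplacian c c)).const_mul (4 / 3)).div hwt (by simpa using hw0)
    refine h2.congr_deriv ?_
    simp only [id, zero_mul, add_zero]
    field_simp
  have hQt : HasDerivAt (fun t : ℝ => 10 / 9 * (jetGradInner c c c + 2 * t * jetGradInner c c K
      + t ^ 2 * jetGradInner c K K) / (w + t * v) ^ 2)
      (20 / 9 * jetGradInner c c K / w ^ 2 - 20 / 9 * jetGradInner c c c * v / w ^ 3) 0 := by
    have h2 := ((((((hasDerivAt_id (0 : ℝ)).const_mul 2).mul_const (jetGradInner c c K)).const_add
      (jetGradInner c c c)).add (((hasDerivAt_id (0 : ℝ)).pow 2).mul_const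
        (jetGradInner c K K))).const_mul (10 / 9)).div (hwt.pow 2) (by simpa using hw0)
    refine h2.congr_deriv ?_
    simp
    field_simp
    ring
  have h3 := hkin.sub (hrp.mul (((hasDerivAt_const (0 : ℝ) (jetCurvature c)).sub hLt).add hQt))
  have h4 : HasDerivAt (fun t : ℝ => jetConstraint (c + t • K)) _ 0 :=
    h3.congr_of_eventuallyEq (Filter.Eventually.of_forall eF)
  rw [h1.unique h4, jetConformalCurvature, ← hwdef]
  simp
  ring

end
end ShapeDynamics

namespace ShapeDynamics
noncomputable section

/-! ### Families of functions depending smoothly on a parameter -/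

section Families

variable {A : ℝ → E3 → ℝ} {I : Set ℝ} {U : Set E3} {ε : ℝ} {y : E3}

theorem pd_eq_fderiv_prod (hI : IsOpen I) (hU : IsOpen U)
    (hA : ContDiffOn ℝ ∞ (fun p : ℝ × E3 => A p.1 p.2) (I ×ˢ U)) (hε : ε ∈ I) (hy : y ∈ U)
    (i : Fin 3) : pd i (A ε) y =
      fderiv ℝ (fun p : ℝ × E3 => A p.1 p.2) (ε, y) (0, EuclideanSpace.single i 1) := by
  have hd : DifferentiableAt ℝ (fun p : ℝ × E3 => A p.1 p.2) (ε, y) :=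
    (hA.contDiffAt ((hI.prod hU).mem_nhds ⟨hε, hy⟩)).differentiableAt (by simp)
  have h := hd.hasFDerivAt.comp y (hasFDerivAt_prodMk_right (𝕜 := ℝ) ε y)
  have h2 : HasFDerivAt (A ε) _ y := h
  rw [pd, h2.fderiv]
  simp

theorem deriv_eq_fderiv_prod (hI : IsOpen I) (hU : IsOpen U)
    (hA : ContDiffOn ℝ ∞ (fun p : ℝ × E3 => A p.1 p.2) (I ×ˢ U)) (hε : ε ∈ I) (hy : y ∈ U) :
    HasDerivAt (fun e => A e y) (fderiv ℝ (fun p : ℝ × E3 => A p.1 p.2) (ε, y) (1, 0)) ε := by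
  have hd : DifferentiableAt ℝ (fun p : ℝ × E3 => A p.1 p.2) (ε, y) :=
    (hA.contDiffAt ((hI.prod hU).mem_nhds ⟨hε, hy⟩)).differentiableAt (by simp)
  have h := hd.hasFDerivAt.comp ε (hasFDerivAt_prodMk_left (𝕜 := ℝ) ε y)
  simpa using (show HasFDerivAt (fun e => A e y) _ ε from h).hasDerivAt

theorem contDiffOn_param_pd (hI : IsOpen I) (hU : IsOpen U)
    (hA : ContDiffOn ℝ ∞ (fun p : ℝ × E3 => A p.1 p.2) (I ×ˢ U)) (i : Fin 3) :
    ContDiffOn ℝ ∞ (fun p : ℝ × E3 => pd i (A p.1) p.2) (I ×ˢ U) :=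
  ((hA.fderiv_of_isOpen (hI.prod hU) (by simp)).clm_apply contDiffOn_const).congr
    fun _ hp => pd_eq_fderiv_prod hI hU hA hp.1 hp.2 i

theorem contDiffOn_param_deriv (hI : IsOpen I) (hU : IsOpen U)
    (hA : ContDiffOn ℝ ∞ (fun p : ℝ × E3 => A p.1 p.2) (I ×ˢ U)) :
    ContDiffOn ℝ ∞ (fun p : ℝ × E3 => deriv (fun e => A e p.2) p.1) (I ×ˢ U) :=
  ((hA.fderiv_of_isOpen (hI.prod hU) (by simp)).clm_apply contDiffOn_const).congr
    fun _ hp => (deriv_eq_fderiv_prod hI hU hA hp.1 hp.2).deriv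

theorem contDiffOn_param_left (hA : ContDiffOn ℝ ∞ (fun p : ℝ × E3 => A p.1 p.2) (I ×ˢ U))
    (hy : y ∈ U) : ContDiffOn ℝ ∞ (fun e => A e y) I :=
  hA.comp (contDiffOn_id.prodMk contDiffOn_const) fun _ he => ⟨he, hy⟩

theorem contDiffOn_param_right (hA : ContDiffOn ℝ ∞ (fun p : ℝ × E3 => A p.1 p.2) (I ×ˢ U))
    (hε : ε ∈ I) : ContDiffOn ℝ ∞ (A ε) U :=
  hA.comp (contDiffOn_const.prodMk contDiffOn_id) fun _ hz => ⟨hε, hz⟩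

/-- Symmetry of the second derivative of the joint function on `ℝ × E3`, evaluated on the parameter
direction and a coordinate direction. -/
theorem deriv_pd_comm (hI : IsOpen I) (hU : IsOpen U)
    (hA : ContDiffOn ℝ ∞ (fun p : ℝ × E3 => A p.1 p.2) (I ×ˢ U)) (hε : ε ∈ I) (hy : y ∈ U)
    (i : Fin 3) :
    deriv (fun e => pd i (A e) y) ε = pd i (fun z => deriv (fun e => A e z) ε) y := by
  set B : ℝ × E3 → ℝ := fun p => A p.1 p.2
  have hB : ContDiffAt ℝ ∞ B (ε, y) := hA.contDiffAt ((hI.prod hU).mem_nhds ⟨hε, hy⟩)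
  have hd : DifferentiableAt ℝ (fderiv ℝ B) (ε, y) :=
    (hB.fderiv_right (m := ∞) (by simp)).differentiableAt (by simp)
  have h1 := (deriv_eq_fderiv_prod (A := fun e z => pd i (A e) z) hI hU
    (contDiffOn_param_pd hI hU hA i) hε hy).deriv
  have h2 := pd_eq_fderiv_prod (A := fun e z => deriv (fun e => A e z) e) hI hU
    (contDiffOn_param_deriv hI hU hA) hε hy i
  have hnhds : I ×ˢ U ∈ 𝓝 (ε, y) := (hI.prod hU).mem_nhds ⟨hε, hy⟩
  have key : ∀ v w : ℝ × E3, fderiv ℝ (fun p => fderiv ℝ B p v) (ε, y) w =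
      fderiv ℝ (fderiv ℝ B) (ε, y) w v := fun v w => by
    rw [fderiv_clm_apply hd (differentiableAt_const v)]
    simp
  have e1 : (fun p : ℝ × E3 => pd i (A p.1) p.2) =ᶠ[𝓝 (ε, y)]
      fun p => fderiv ℝ B p (0, EuclideanSpace.single i 1) := by
    filter_upwards [hnhds] with p hp using pd_eq_fderiv_prod hI hU hA hp.1 hp.2 i
  have e2 : (fun p : ℝ × E3 => deriv (fun e => A e p.2) p.1) =ᶠ[𝓝 (ε, y)]
      fun p => fderiv ℝ B p (1, 0) := by
    filter_upwards [hnhds] with p hp using (deriv_eq_fderiv_prod hI hU hA hp.1 hp.2).deriv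
  rw [h1, h2, e1.fderiv_eq, e2.fderiv_eq, key, key]
  exact (hB.isSymmSndFDerivAt (by
    rw [minSmoothness_of_isRCLikeNormedField]
    exact (WithTop.coe_le_coe.2 le_top : ((2 : ℕ∞) : WithTop ℕ∞) ≤ ∞))).eq _ _

theorem contDiffOn_param_iteratedDeriv (hI : IsOpen I) (hU : IsOpen U)
    (hA : ContDiffOn ℝ ∞ (fun p : ℝ × E3 => A p.1 p.2) (I ×ˢ U)) (k : ℕ) :
    ContDiffOn ℝ ∞ (fun p : ℝ × E3 => iteratedDeriv k (fun e => A e p.2) p.1) (I ×ˢ U) := by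
  induction k with
  | zero => simpa using hA
  | succ k ih =>
    simp only [iteratedDeriv_succ]
    exact contDiffOn_param_deriv (A := fun e z => iteratedDeriv k (fun e => A e z) e) hI hU ih

theorem iteratedDeriv_pd_comm (hI : IsOpen I) (hU : IsOpen U)
    (hA : ContDiffOn ℝ ∞ (fun p : ℝ × E3 => A p.1 p.2) (I ×ˢ U)) (hε : ε ∈ I) (hy : y ∈ U)
    (i : Fin 3) (k : ℕ) :
    iteratedDeriv k (fun e => pd i (A e) y) ε =
      pd i (fun z => iteratedDeriv k (fun e => A e z) ε) y := by
  induction k generalizing ε with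
  | zero => simp
  | succ k ih =>
    simp only [iteratedDeriv_succ]
    have : iteratedDeriv k (fun e => pd i (A e) y) =ᶠ[𝓝 ε]
        fun e => pd i (fun z => iteratedDeriv k (fun e => A e z) e) y := by
      filter_upwards [hI.mem_nhds hε] with e he using ih he
    rw [this.deriv_eq]
    exact deriv_pd_comm (A := fun e z => iteratedDeriv k (fun e => A e z) e) hI hU
      (contDiffOn_param_iteratedDeriv hI hU hA k) hε hy i

theorem epsCoeff_pd (hI : IsOpen I) (h0 : (0 : ℝ) ∈ I) (hU : IsOpen U)
    (hA : ContDiffOn ℝ ∞ (fun p : ℝ × E3 => A p.1 p.2) (I ×ˢ U)) (hy : y ∈ U)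
    (i : Fin 3) (k : ℕ) :
    epsCoeff k (fun e => pd i (A e) y) = pd i (fun z => epsCoeff k fun e => A e z) y := by
  simp only [epsCoeff, iteratedDeriv_pd_comm hI hU hA h0 hy, div_eq_inv_mul, pd_const_mul]

theorem epsCoeff_pd_pd (hI : IsOpen I) (h0 : (0 : ℝ) ∈ I) (hU : IsOpen U)
    (hA : ContDiffOn ℝ ∞ (fun p : ℝ × E3 => A p.1 p.2) (I ×ˢ U)) (hy : y ∈ U)
    (i j : Fin 3) (k : ℕ) :
    epsCoeff k (fun e => pd i (pd j (A e)) y) =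
      pd i (pd j fun z => epsCoeff k fun e => A e z) y := by
  rw [epsCoeff_pd (A := fun e => pd j (A e)) hI h0 hU (contDiffOn_param_pd hI hU hA j) hy]
  exact pd_congr_of_isOpen hU hy i fun z hz => epsCoeff_pd hI h0 hU hA hz j k

theorem contDiffOn_epsCoeff (hI : IsOpen I) (h0 : (0 : ℝ) ∈ I) (hU : IsOpen U)
    (hA : ContDiffOn ℝ ∞ (fun p : ℝ × E3 => A p.1 p.2) (I ×ˢ U)) (k : ℕ) :
    ContDiffOn ℝ ∞ (fun z => epsCoeff k fun e => A e z) U :=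
  (contDiffOn_param_right (A := fun e z => iteratedDeriv k (fun e => A e z) e)
    (contDiffOn_param_iteratedDeriv hI hU hA k) h0).div_const _

/-! ### Integrals depending on a parameter -/

open MeasureTheory

theorem hasDerivAt_integral_of_compact (hI : IsOpen I) {K : Set E3} (hK : IsCompact K)
    (hA : ContDiffOn ℝ ∞ (fun p : ℝ × E3 => A p.1 p.2) (I ×ˢ Set.univ))
    (hz : ∀ e ∈ I, ∀ z ∉ K, A e z = 0) (hε : ε ∈ I) :
    HasDerivAt (fun e => ∫ z, A e z) (∫ z, deriv (fun e => A e z) ε) ε := by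
  have hcont : ∀ e ∈ I, Continuous (A e) := fun e he =>
    continuousOn_univ.1 (contDiffOn_param_right hA he).continuousOn
  have hdA := contDiffOn_param_deriv hI isOpen_univ hA
  have hdcont : ∀ e ∈ I, Continuous fun z => deriv (fun e => A e z) e := fun e he =>
    continuousOn_univ.1 (contDiffOn_param_right (A := fun e z => deriv (fun e => A e z) e)
      hdA he).continuousOn
  obtain ⟨r, hr, hrI⟩ := Metric.nhds_basis_closedBall.mem_iff.1 (hI.mem_nhds hε)
  have hcpt : IsCompact (Metric.closedBall ε r ×ˢ K) := (isCompact_closedBall ε r).prod hK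
  -- The parameter derivative is bounded by `C` on a compact product and vanishes off `K`, so `C`
  -- times the indicator of `K` is an integrable dominating function.
  obtain ⟨C, hC⟩ := hcpt.exists_bound_of_continuousOn
    (hdA.continuousOn.mono (Set.prod_mono hrI (Set.subset_univ K)))
  have hzero : ∀ e ∈ I, ∀ z ∉ K, deriv (fun e => A e z) e = 0 := fun e he z hzK => by
    have : (fun e => A e z) =ᶠ[𝓝 e] fun _ => 0 := by
      filter_upwards [hI.mem_nhds he] with e' he' using hz e' he' z hzK
    rw [this.deriv_eq, deriv_const]
  refine (hasDerivAt_integral_of_dominated_loc_of_deriv_le (s := Metric.closedBall ε r)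
    (bound := K.indicator fun _ => C) (F := fun e z => A e z)
    (F' := fun e z => deriv (fun e => A e z) e)
    (Metric.closedBall_mem_nhds ε hr) ?_ ?_ (hdcont ε hε).aestronglyMeasurable
    (Filter.Eventually.of_forall fun z e he => ?_) ?_
    (Filter.Eventually.of_forall fun z e he => ?_)).2
  · filter_upwards [hI.mem_nhds hε] with e he using (hcont e he).aestronglyMeasurable
  · exact (hcont ε hε).integrable_of_hasCompactSupport (HasCompactSupport.intro hK (hz ε hε))
  · by_cases hzK : z ∈ K
    · rw [Set.indicator_of_mem hzK]
      exact hC (e, z) ⟨he, hzK⟩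
    · rw [Set.indicator_of_notMem hzK, hzero e (hrI he) z hzK, norm_zero]
  · exact (integrable_indicator_iff hK.measurableSet).2
      (integrableOn_const hK.measure_lt_top.ne)
  · have := deriv_eq_fderiv_prod hI isOpen_univ hA (hrI he) (Set.mem_univ z)
    rw [this.deriv]; exact this

theorem iteratedDeriv_integral_of_compact (hI : IsOpen I) {K : Set E3} (hK : IsCompact K)
    (hA : ContDiffOn ℝ ∞ (fun p : ℝ × E3 => A p.1 p.2) (I ×ˢ Set.univ))
    (hz : ∀ e ∈ I, ∀ z ∉ K, A e z = 0) (k : ℕ) (hε : ε ∈ I) :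
    HasDerivAt (iteratedDeriv k fun e => ∫ z, A e z)
        (∫ z, iteratedDeriv (k + 1) (fun e => A e z) ε) ε ∧
      iteratedDeriv k (fun e => ∫ z, A e z) ε = ∫ z, iteratedDeriv k (fun e => A e z) ε := by
  induction k generalizing ε with
  | zero => simpa using hasDerivAt_integral_of_compact hI hK hA hz hε
  | succ k ih =>
    have h1 : ∀ e ∈ I, iteratedDeriv (k + 1) (fun e => ∫ z, A e z) e =
        ∫ z, iteratedDeriv (k + 1) (fun e => A e z) e := fun e he => by
      rw [iteratedDeriv_succ, (ih he).1.deriv]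
    have hz' : ∀ e ∈ I, ∀ z ∉ K, iteratedDeriv (k + 1) (fun e => A e z) e = 0 := by
      intro e he z hzK
      have : (fun e => A e z) =ᶠ[𝓝 e] fun _ => 0 := by
        filter_upwards [hI.mem_nhds he] with e' he' using hz e' he' z hzK
      rw [this.iteratedDeriv_eq, iteratedDeriv_const]
      simp
    refine ⟨?_, h1 ε hε⟩
    have h2 := hasDerivAt_integral_of_compact (A := fun e z => iteratedDeriv (k + 1)
      (fun e => A e z) e) hI hK (contDiffOn_param_iteratedDeriv hI isOpen_univ hA (k + 1)) hz' hε
    simp only [iteratedDeriv_succ (n := k + 1)]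
    refine h2.congr_of_eventuallyEq ?_
    filter_upwards [hI.mem_nhds hε] with e he using h1 e he

theorem contDiffAt_integral_of_compact (hI : IsOpen I) {K : Set E3} (hK : IsCompact K)
    (hA : ContDiffOn ℝ ∞ (fun p : ℝ × E3 => A p.1 p.2) (I ×ˢ Set.univ))
    (hz : ∀ e ∈ I, ∀ z ∉ K, A e z = 0) (hε : ε ∈ I) :
    ContDiffAt ℝ ∞ (fun e => ∫ z, A e z) ε := by
  refine ContDiffOn.contDiffAt (s := I) ?_ (hI.mem_nhds hε)
  refine contDiffOn_of_differentiableOn_deriv fun m _ e he => ?_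
  have h := (iteratedDeriv_integral_of_compact hI hK hA hz m he).1.differentiableAt
  exact h.differentiableWithinAt.congr (fun e' he' => iteratedDerivWithin_of_isOpen hI he')
    (iteratedDerivWithin_of_isOpen hI he)

theorem epsCoeff_integral_of_compact (hI : IsOpen I) (h0 : (0 : ℝ) ∈ I) {K : Set E3}
    (hK : IsCompact K) (hA : ContDiffOn ℝ ∞ (fun p : ℝ × E3 => A p.1 p.2) (I ×ˢ Set.univ))
    (hz : ∀ e ∈ I, ∀ z ∉ K, A e z = 0) (k : ℕ) :
    epsCoeff k (fun e => ∫ z, A e z) = ∫ z, epsCoeff k fun e => A e z := by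
  simp only [epsCoeff, (iteratedDeriv_integral_of_compact hI hK hA hz k h0).2, integral_div]

end Families
end
end ShapeDynamics

namespace ShapeDynamics
noncomputable section

open MeasureTheory

/-! ### Components of tensor fields in charts -/

section Charts

variable {M : Type*} [TopologicalSpace M] [ChartedSpace E3 M] [IsManifold (𝓡 3) ∞ M]

theorem clm_apply_eq_sum (L : E3 →L[ℝ] E3) (v : E3) (i : Fin 3) :
    L v i = ∑ k, v k * L (EuclideanSpace.single k 1) i := by
  have hv : v = ∑ k, v k • (EuclideanSpace.single k 1 : E3) := by
    ext j
    simp [Finset.sum_apply, Pi.single_apply]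
  conv_lhs => rw [hv]
  simp

/-- The coordinate change in the opposite direction provides a left inverse of the Jacobian, by the
cocycle rule. -/
theorem det_jac_ne_zero {c x : M} (hx : x ∈ (extChartAt (𝓡 3) c).source) :
    (jac c x).det ≠ 0 := by
  let N : Mat3 := Matrix.of fun k i =>
    (tangentCoordChange (𝓡 3) x c x (EuclideanSpace.single i 1 : E3) : E3) k
  have hxx : x ∈ (extChartAt (𝓡 3) x).source := mem_extChartAt_source x
  have h : N * jac c x = 1 := by
    ext i j
    have h1 := clm_apply_eq_sum (tangentCoordChange (𝓡 3) x c x)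
      (tangentCoordChange (𝓡 3) c x x (EuclideanSpace.single j 1 : E3)) i
    rw [tangentCoordChange_comp ⟨⟨hx, hxx⟩, hx⟩, tangentCoordChange_self hx] at h1
    rw [Matrix.mul_apply, Matrix.one_apply]
    simp only [PiLp.single_apply] at h1
    rw [h1]
    exact Finset.sum_congr rfl fun k _ => mul_comm _ _
  intro h0
  have := congrArg Matrix.det h
  rw [Matrix.det_mul, h0, mul_zero, Matrix.det_one] at this
  exact zero_ne_one this

theorem jac_self (x : M) : jac x x = 1 := by
  ext i j
  simp only [jac, Matrix.of_apply, tangentCoordChange_self (mem_extChartAt_source (I := 𝓡 3) x)]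
  simp [Matrix.one_apply]

theorem covComp_self (g : M → Mat3) (x : M) : covComp x g (extChartAt (𝓡 3) x x) = g x := by
  simp [covComp, jac_self]

theorem densComp_self (π : M → Mat3) (x : M) : densComp x π (extChartAt (𝓡 3) x x) = π x := by
  simp [densComp, jac_self]

theorem covComp_symm (c : M) {g : M → Mat3} (hg : ∀ x, (g x).IsSymm) (y : E3) :
    (covComp c g y).IsSymm := by
  simp only [covComp, Matrix.IsSymm, Matrix.transpose_mul, Matrix.transpose_transpose, (hg _).eq,
    Matrix.mul_assoc]

theorem det_covComp (c : M) (g : M → Mat3) (y : E3) :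
    (covComp c g y).det = (jac c ((extChartAt (𝓡 3) c).symm y)).det ^ 2 *
      (g ((extChartAt (𝓡 3) c).symm y)).det := by
  simp only [covComp, Matrix.det_mul, Matrix.det_transpose]
  ring

theorem covComp_smul (c : M) (u : M → ℝ) (g : M → Mat3) (y : E3) :
    covComp c (fun x => u x • g x) y = u ((extChartAt (𝓡 3) c).symm y) • covComp c g y := by
  simp only [covComp, Matrix.mul_smul, Matrix.smul_mul]

theorem det_jac_symm_ne_zero {c : M} {y : E3} (hy : y ∈ (extChartAt (𝓡 3) c).target) :
    (jac c ((extChartAt (𝓡 3) c).symm y)).det ≠ 0 :=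
  det_jac_ne_zero ((extChartAt (𝓡 3) c).map_target hy)

theorem scalarDensComp_sqrtDet (c : M) (g : M → Mat3) (y : E3) :
    scalarDensComp c (sqrtDet g) y = Real.sqrt (covComp c g y).det := by
  rw [det_covComp, Real.sqrt_mul (sq_nonneg _), Real.sqrt_sq_eq_abs]
  rfl

/-- The Jacobians of `π` and `g` cancel under the trace, and the remaining determinant is the
density weight. Joint smoothness of the integrand thus follows from that of the chart components. -/
theorem scalarDensComp_momTrace {c : M} (g π : M → Mat3) {y : E3}
    (hy : y ∈ (extChartAt (𝓡 3) c).target) :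
    scalarDensComp c (momTrace g π) y =
      ∑ a, ∑ b, densComp c π y a b * covComp c g y a b := by
  have tr : ∀ A B : Mat3, ∑ a, ∑ b, A a b * B a b = (A * B.transpose).trace := by
    intro A B
    simp [Matrix.trace, Matrix.mul_apply]
  simp only [scalarDensComp, momTrace, tr, densComp, covComp]
  set J := jac c ((extChartAt (𝓡 3) c).symm y)
  have hJ : IsUnit J.det := (det_jac_symm_ne_zero hy).isUnit
  set P := π ((extChartAt (𝓡 3) c).symm y)
  set Q := g ((extChartAt (𝓡 3) c).symm y)
  have hJ' : IsUnit (J.transpose).det := by rwa [Matrix.det_transpose]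
  have h1 : (J⁻¹).transpose * J.transpose = 1 := by
    rw [Matrix.transpose_nonsing_inv, Matrix.nonsing_inv_mul _ hJ']
  rw [Matrix.smul_mul, Matrix.trace_smul, smul_eq_mul]
  congr 1
  have h2 : J⁻¹ * P * (J⁻¹).transpose * (J.transpose * Q * J).transpose =
      J⁻¹ * (P * Q.transpose * J) := by
    simp only [Matrix.transpose_mul, Matrix.transpose_transpose]
    calc J⁻¹ * P * (J⁻¹).transpose * (J.transpose * (Q.transpose * J))
        = J⁻¹ * P * ((J⁻¹).transpose * J.transpose) * (Q.transpose * J) := by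
          simp only [Matrix.mul_assoc]
      _ = J⁻¹ * (P * Q.transpose * J) := by rw [h1]; simp only [Matrix.mul_assoc, Matrix.mul_one]
  rw [h2, Matrix.trace_mul_comm J⁻¹, Matrix.mul_assoc (P * Q.transpose), Matrix.mul_nonsing_inv _ hJ, Matrix.mul_one]

theorem IsRiemannianMetric.symm {g : M → Mat3} (hg : IsRiemannianMetric g) (x : M) :
    (g x).IsSymm := by
  obtain ⟨G, hG⟩ := hg
  ext i j
  rw [Matrix.transpose_apply, hG, hG]
  exact G.symm x _ _

theorem IsRiemannianMetric.det_pos {g : M → Mat3} (hg : IsRiemannianMetric g) (x : M) :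
    0 < (g x).det := by
  have hs := hg.symm x
  obtain ⟨G, hG⟩ := hg
  refine Matrix.PosDef.det_pos (Matrix.PosDef.of_dotProduct_mulVec_pos ?_ fun v hv => ?_)
  · rw [Matrix.IsHermitian, Matrix.conjTranspose_eq_transpose_of_trivial]; exact hs
  · let b : Fin 3 → TangentSpace (𝓡 3) x := fun i => (EuclideanSpace.single i 1 : E3)
    let u : TangentSpace (𝓡 3) x := ∑ i, v i • b i
    have hu : u ≠ 0 := by
      intro h
      refine hv (funext fun j => ?_)
      have h1 : (∑ i, v i • (EuclideanSpace.single i 1 : E3)) = 0 := h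
      have h2 := congrArg (fun w : E3 => w j) h1
      simpa [Finset.sum_apply, Pi.single_apply] using h2
    have hp := G.pos x u hu
    have e : G.inner x u u = star v ⬝ᵥ (g x).mulVec v := by
      simp only [u, map_sum, map_smul, dotProduct, Matrix.mulVec, hG, star_trivial,
        sum_apply, smul_apply, smul_eq_mul, Finset.mul_sum]
      rw [Finset.sum_comm]
      refine Finset.sum_congr rfl fun i _ => Finset.sum_congr rfl fun j _ => ?_
      ring
    rwa [e] at hp

/-! ### Integrals of scalar densities over the compact manifold. -/

section Integration

variable [T2Space M] [CompactSpace M]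

theorem chartPartition_isSubordinate :
    (chartPartition M).IsSubordinate fun x => (chartAt E3 x).source :=
  (SmoothPartitionOfUnity.exists_isSubordinate_chartAt_source (𝓡 3) M).choose_spec

/-- The image in the chart at `c` of the support of the corresponding partition function. -/
def chartSupport (c : M) : Set E3 := extChartAt (𝓡 3) c '' tsupport (chartPartition M c)

theorem tsupport_subset_source (c : M) :
    tsupport (chartPartition M c) ⊆ (extChartAt (𝓡 3) c).source := by
  rw [extChartAt_source]
  exact chartPartition_isSubordinate c

theorem isCompact_chartSupport (c : M) : IsCompact (chartSupport c) :=
  (isClosed_tsupport _).isCompact.image_of_continuousOn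
    ((continuousOn_extChartAt c).mono (tsupport_subset_source c))

theorem chartSupport_subset (c : M) : chartSupport c ⊆ (extChartAt (𝓡 3) c).target := by
  rintro _ ⟨x, hx, rfl⟩
  exact (extChartAt (𝓡 3) c).map_source (tsupport_subset_source c hx)

theorem chartPartition_symm_eq_zero {c : M} {y : E3} (hy : y ∈ (extChartAt (𝓡 3) c).target)
    (hyK : y ∉ chartSupport c) : chartPartition M c ((extChartAt (𝓡 3) c).symm y) = 0 := by
  by_contra h
  exact hyK ⟨_, subset_tsupport _ h, (extChartAt (𝓡 3) c).right_inv hy⟩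

theorem contDiffOn_chartPartition (c : M) :
    ContDiffOn ℝ ∞ (fun y => chartPartition M c ((extChartAt (𝓡 3) c).symm y))
      (extChartAt (𝓡 3) c).target := by
  have h := (chartPartition M c).contMDiff.comp_contMDiffOn
    (contMDiffOn_extChartAt_symm (I := 𝓡 3) (n := ∞) c)
  exact contMDiffOn_iff_contDiffOn.1 h

/-- The integrand of `densIntegral` in the chart at `c`, extended by zero. -/
def chartIntegrand (c : M) (ρ : M → ℝ) (y : E3) : ℝ :=
  (extChartAt (𝓡 3) c).target.indicator
    (fun y => chartPartition M c ((extChartAt (𝓡 3) c).symm y) * scalarDensComp c ρ y) y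

/-- By local finiteness and compactness only finitely many partition functions are nonzero. The
finite set serves all densities at once, hence whole families. -/
theorem exists_finset_densIntegral_eq (M : Type*) [TopologicalSpace M] [ChartedSpace E3 M]
    [IsManifold (𝓡 3) ∞ M] [T2Space M] [CompactSpace M] :
    ∃ s : Finset M, (∀ c ∉ s, ∀ x, chartPartition M c x = 0) ∧
      ∀ ρ : M → ℝ, densIntegral ρ = ∑ c ∈ s, ∫ y, chartIntegrand c ρ y := by
  have hfin := (chartPartition M).locallyFinite.finite_nonempty_of_compact
  refine ⟨hfin.toFinset, fun c hc => ?_, fun ρ => ?_⟩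
  · simp only [Set.Finite.mem_toFinset, Set.mem_ofPred_eq, Set.not_nonempty_iff_eq_empty,
      Function.support_eq_empty_iff] at hc
    exact congrFun hc
  · have e : ∀ c : M, ∫ y, chartIntegrand c ρ y = ∫ y in (extChartAt (𝓡 3) c).target,
        chartPartition M c ((extChartAt (𝓡 3) c).symm y) * scalarDensComp c ρ y := fun c =>
      integral_indicator (isOpen_extChartAt_target c).measurableSet
    simp only [e]
    refine finsum_eq_sum_of_support_subset _ fun c hc => ?_
    simp only [Set.Finite.coe_toFinset, Set.mem_ofPred_eq]
    by_contra h
    rw [Set.not_nonempty_iff_eq_empty, Function.support_eq_empty_iff] at h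
    refine hc ?_
    simp [h]

/-- No integrability is assumed, so this applies to the integrals in the source term for arbitrary
coefficient fields. -/
theorem densIntegral_const_mul (s : ℝ) (ρ : M → ℝ) :
    densIntegral (fun x => s * ρ x) = s * densIntegral ρ := by
  obtain ⟨S, -, hS⟩ := exists_finset_densIntegral_eq M
  rw [hS, hS, Finset.mul_sum]
  refine Finset.sum_congr rfl fun c _ => ?_
  rw [← integral_const_mul]
  congr 1
  funext y
  simp only [chartIntegrand, Set.indicator, scalarDensComp]
  split_ifs <;> ring

theorem chartIntegrand_eq_zero {c : M} (ρ : M → ℝ) {y : E3} (hy : y ∉ chartSupport c) :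
    chartIntegrand c ρ y = 0 := by
  by_cases ht : y ∈ (extChartAt (𝓡 3) c).target
  · rw [chartIntegrand, Set.indicator_of_mem ht, chartPartition_symm_eq_zero ht hy, zero_mul]
  · rw [chartIntegrand, Set.indicator_of_notMem ht]

/-- Extension by zero stays smooth because the partition function is supported in a compact subset
of the chart domain: the integrand vanishes in a neighbourhood of every point outside the target. -/
theorem contDiffOn_chartIntegrand {I : Set ℝ} (hI : IsOpen I) {ρ : ℝ → M → ℝ} (c : M)
    (hρ : ContDiffOn ℝ ∞ (fun p : ℝ × E3 => scalarDensComp c (ρ p.1) p.2)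
      (I ×ˢ (extChartAt (𝓡 3) c).target)) :
    ContDiffOn ℝ ∞ (fun p : ℝ × E3 => chartIntegrand c (ρ p.1) p.2) (I ×ˢ Set.univ) := by
  have hT : IsOpen (extChartAt (𝓡 3) c).target := isOpen_extChartAt_target c
  rintro ⟨e, y⟩ ⟨he, -⟩
  refine ContDiffAt.contDiffWithinAt ?_
  by_cases hy : y ∈ (extChartAt (𝓡 3) c).target
  · have h1 : ContDiffOn ℝ ∞ (fun p : ℝ × E3 => chartPartition M c ((extChartAt (𝓡 3) c).symm p.2)
        * scalarDensComp c (ρ p.1) p.2) (I ×ˢ (extChartAt (𝓡 3) c).target) :=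
      ((contDiffOn_chartPartition c).comp contDiffOn_snd fun p hp => hp.2).mul hρ
    refine (h1.contDiffAt ((hI.prod hT).mem_nhds ⟨he, hy⟩)).congr_of_eventuallyEq ?_
    filter_upwards [(hI.prod hT).mem_nhds (show (e, y) ∈ I ×ˢ _ from ⟨he, hy⟩)] with p hp
    rw [chartIntegrand, Set.indicator_of_mem hp.2]
  · have hyK : y ∉ chartSupport c := fun h => hy (chartSupport_subset c h)
    refine (contDiffAt_const (c := (0 : ℝ))).congr_of_eventuallyEq ?_
    have hopen : IsOpen (chartSupport c)ᶜ := (isCompact_chartSupport c).isClosed.isOpen_compl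
    filter_upwards [(hI.prod hopen).mem_nhds (show (e, y) ∈ I ×ˢ _ from ⟨he, hyK⟩)] with p hp
    exact chartIntegrand_eq_zero _ hp.2

theorem contDiffAt_densIntegral {I : Set ℝ} (hI : IsOpen I) {ρ : ℝ → M → ℝ} {ε : ℝ} (hε : ε ∈ I)
    (hρ : ∀ c, ContDiffOn ℝ ∞ (fun p : ℝ × E3 => scalarDensComp c (ρ p.1) p.2)
      (I ×ˢ (extChartAt (𝓡 3) c).target)) :
    ContDiffAt ℝ ∞ (fun e => densIntegral (ρ e)) ε := by
  obtain ⟨s, -, hs⟩ := exists_finset_densIntegral_eq M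
  simp only [hs]
  exact ContDiffAt.sum fun c _ => contDiffAt_integral_of_compact
    (A := fun e => chartIntegrand c (ρ e)) hI (isCompact_chartSupport c)
    (contDiffOn_chartIntegrand hI c (hρ c)) (fun e _ z hz => chartIntegrand_eq_zero _ hz) hε

theorem epsCoeff_densIntegral {I : Set ℝ} (hI : IsOpen I) (h0 : (0 : ℝ) ∈ I) {ρ : ℝ → M → ℝ}
    (hρ : ∀ c, ContDiffOn ℝ ∞ (fun p : ℝ × E3 => scalarDensComp c (ρ p.1) p.2)
      (I ×ˢ (extChartAt (𝓡 3) c).target)) (k : ℕ) :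
    epsCoeff k (fun e => densIntegral (ρ e)) =
      densIntegral fun x => epsCoeff k fun e => ρ e x := by
  obtain ⟨s, -, hs⟩ := exists_finset_densIntegral_eq M
  simp only [hs]
  rw [epsCoeff_sum fun c _ => contDiffAt_integral_of_compact
    (A := fun e => chartIntegrand c (ρ e)) hI (isCompact_chartSupport c)
    (contDiffOn_chartIntegrand hI c (hρ c)) (fun e _ z hz => chartIntegrand_eq_zero _ hz) h0]
  refine Finset.sum_congr rfl fun c _ => ?_
  rw [epsCoeff_integral_of_compact (A := fun e => chartIntegrand c (ρ e)) hI h0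
    (isCompact_chartSupport c) (contDiffOn_chartIntegrand hI c (hρ c))
    (fun e _ z hz => chartIntegrand_eq_zero _ hz)]
  congr 1
  funext y
  by_cases hy : y ∈ (extChartAt (𝓡 3) c).target
  · simp only [chartIntegrand, Set.indicator_of_mem hy, scalarDensComp, ← mul_assoc,
      epsCoeff_const_mul]
  · simp only [chartIntegrand, Set.indicator_of_notMem hy]
    simpa using epsCoeff_const_mul k 0 fun _ => 0

/-- Some partition function is positive at a given point, and the corresponding continuous
nonnegative integrand is nonzero at the image of that point. -/
theorem densIntegral_pos [Nonempty M] {ρ : M → ℝ} (hpos : ∀ x, 0 < ρ x)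
    (hρ : ∀ c, ContDiffOn ℝ ∞ (scalarDensComp c ρ) (extChartAt (𝓡 3) c).target) :
    0 < densIntegral ρ := by
  obtain ⟨s, hs0, hs⟩ := exists_finset_densIntegral_eq M
  rw [hs]
  have hnn : ∀ c y, 0 ≤ chartIntegrand c ρ y := fun c y =>
    Set.indicator_nonneg (fun z _ => mul_nonneg ((chartPartition M).nonneg c _)
      (mul_nonneg (abs_nonneg _) (hpos _).le)) y
  obtain ⟨x⟩ := ‹Nonempty M›
  obtain ⟨c, hc⟩ := (chartPartition M).exists_pos_of_mem (Set.mem_univ x)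
  have hcs : c ∈ s := by
    by_contra h
    exact hc.ne' (hs0 c h x)
  refine Finset.sum_pos' (fun c _ => integral_nonneg (hnn c)) ⟨c, hcs, ?_⟩
  have hxs : x ∈ (extChartAt (𝓡 3) c).source :=
    tsupport_subset_source c (subset_tsupport _ hc.ne')
  have hyt := (extChartAt (𝓡 3) c).map_source hxs
  have hcont : Continuous (chartIntegrand c ρ) := by
    have h1 := contDiffOn_chartIntegrand (ρ := fun _ => ρ) isOpen_univ c
      ((hρ c).comp contDiffOn_snd fun p hp => hp.2)
    exact continuousOn_univ.1 (contDiffOn_param_right (A := fun _ => chartIntegrand c ρ)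
      (ε := 0) h1 (Set.mem_univ _)).continuousOn
  refine hcont.integral_pos_of_hasCompactSupport_nonneg_nonzero
    (HasCompactSupport.intro (isCompact_chartSupport c) fun y hy => chartIntegrand_eq_zero _ hy)
    (hnn c) (x := extChartAt (𝓡 3) c x) ?_
  rw [chartIntegrand, Set.indicator_of_mem hyt]
  refine mul_ne_zero ?_ (mul_ne_zero (abs_ne_zero.2 (det_jac_symm_ne_zero hyt)) (hpos _).ne')
  rw [(extChartAt (𝓡 3) c).left_inv hxs]
  exact hc.ne'

end Integration
end Charts
end
end ShapeDynamics

namespace ShapeDynamics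
noncomputable section

open JetIndex

/-! ### Jets of fields, and the constraint as a function of jets. -/

section Main

variable {M : Type*} [TopologicalSpace M] [ChartedSpace E3 M] [IsManifold (𝓡 3) ∞ M]

/-- The jet at `x`, in the preferred chart at `x`, of a metric, a momentum and a conformal factor,
together with two numbers for the integrals. -/
def fieldJet (x : M) (g π : M → Mat3) (w : M → ℝ) (N V : ℝ) : JetIndex → ℝ
  | metric i j => g x i j
  | metricDeriv m i j => pd m (fun y => covComp x g y i j) (extChartAt (𝓡 3) x x)
  | metricDeriv₂ m l i j => pd m (pd l fun y => covComp x g y i j) (extChartAt (𝓡 3) x x)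
  | momentum i j => π x i j
  | momentumIntegral => N
  | volume => V
  | factor => w x
  | factorDeriv i => pd i (fun y => w ((extChartAt (𝓡 3) x).symm y)) (extChartAt (𝓡 3) x x)
  | factorDeriv₂ i j =>
    pd i (pd j fun y => w ((extChartAt (𝓡 3) x).symm y)) (extChartAt (𝓡 3) x x)

theorem pd_const_mul' (i : Fin 3) (c : ℝ) (f : E3 → ℝ) :
    pd i (fun z => c * f z) = fun y => c * pd i f y :=
  funext (pd_const_mul i c f)

/-- The jet is linear in its arguments. The integrals enter as independent numbers because they are
not linear in the fields. -/
theorem fieldJet_smul (s : ℝ) (x : M) (g π : M → Mat3) (w : M → ℝ) (N V : ℝ) :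
    fieldJet x (s • g) (s • π) (s • w) (s * N) (s * V) = s • fieldJet x g π w N V := by
  have hcov : ∀ i j, (fun y => covComp x (s • g) y i j) = fun y => s * covComp x g y i j := by
    intro i j
    funext y
    exact congrFun (congrFun (covComp_smul x (fun _ => s) g y) i) j
  funext i
  cases i <;>
    simp only [fieldJet, hcov, Pi.smul_apply, Matrix.smul_apply, smul_eq_mul, pd_const_mul,
      pd_const_mul']

section FixedFields

variable {x : M} {g π : M → Mat3} {w v : M → ℝ} {N V : ℝ}

theorem jetMetric_fieldJet : jetMetric (fieldJet x g π w N V) = g x := by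
  ext i j; rfl

theorem jetChristoffel_fieldJet (k i j : Fin 3) :
    jetChristoffel (fieldJet x g π w N V) k i j =
      christoffel (covComp x g) k i j (extChartAt (𝓡 3) x x) := by
  rw [christoffel_eq, jetChristoffel, jetMetric_fieldJet, covComp_self]
  rfl

theorem jetLaplacian_fieldJet (g' π' : M → Mat3) (N' V' : ℝ) :
    jetLaplacian (fieldJet x g π w N V) (fieldJet x g' π' v N' V') =
      coordLaplacian (covComp x g) (fun y => v ((extChartAt (𝓡 3) x).symm y))
        (extChartAt (𝓡 3) x x) := by
  simp only [jetLaplacian, jetMetric_fieldJet, jetChristoffel_fieldJet, coordLaplacian,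
    covComp_self]
  rfl

/-- Smoothness, symmetry and positivity of the fields in a chart. -/
structure RegularAt (x : M) (g : M → Mat3) (w : M → ℝ) : Prop where
  symm : ∀ z, (g z).IsSymm
  det_pos : ∀ z, 0 < (g z).det
  metric_smooth : ∀ i j, ContDiffOn ℝ ∞ (fun y => covComp x g y i j) (extChartAt (𝓡 3) x).target
  factor_pos : ∀ z, 0 < w z
  factor_smooth : ContDiffOn ℝ ∞ (fun y => w ((extChartAt (𝓡 3) x).symm y))
    (extChartAt (𝓡 3) x).target

theorem RegularAt.covComp_det_ne_zero (h : RegularAt x g w) {y : E3}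
    (hy : y ∈ (extChartAt (𝓡 3) x).target) : (covComp x g y).det ≠ 0 := by
  rw [det_covComp]
  exact mul_ne_zero (pow_ne_zero _ (det_jac_symm_ne_zero hy)) (h.det_pos _).ne'

theorem jetConformalCurvature_fieldJet (h : RegularAt x g w) :
    jetConformalCurvature (fieldJet x g π w N V) =
      scalarCurvature (fun z => w z ^ (2 / 3 : ℝ) • g z) x := by
  have hy := mem_extChartAt_target (I := 𝓡 3) x
  have hU : IsOpen (extChartAt (𝓡 3) x).target := isOpen_extChartAt_target x
  have hcov : covComp x (fun z => w z ^ (2 / 3 : ℝ) • g z) =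
      fun y => w ((extChartAt (𝓡 3) x).symm y) ^ (2 / 3 : ℝ) • covComp x g y :=
    funext fun y => covComp_smul x _ g y
  have hx : (extChartAt (𝓡 3) x).symm (extChartAt (𝓡 3) x x) = x := extChartAt_to_inv x
  rw [scalarCurvature, hcov, coordScalarCurvature_conformal hU h.metric_smooth
    (fun z _ => covComp_symm x h.symm z) (fun z hz => h.covComp_det_ne_zero hz) h.factor_smooth
    (fun z _ => h.factor_pos _) hy, jetConformalCurvature, jetLaplacian_fieldJet,
    coordScalarCurvature_eq hU h.metric_smooth (fun z hz => h.covComp_det_ne_zero hz) hy, hx]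
  simp only [jetCurvature, jetGradInner, jetMetric_fieldJet, covComp_self]
  rw [show jetChristoffel (fieldJet x g π w N V) =
    christoffelOf (fun i j => (g x)⁻¹ i j) (fun m i j => pd m (fun z => covComp x g z i j)
      (extChartAt (𝓡 3) x x)) from by
    funext k i j
    rw [jetChristoffel, jetMetric_fieldJet]; rfl]
  rfl

/-- The quotient rule gives `-2` and `2` for the gradient terms, and the conformal change adds `1/3`
and `-1/3`. Multiplied by `4/3`, the resulting `∓5/3` are the `∓20/9` of the linearized curvature.
-/
theorem laplacian_div_fieldJet (h : RegularAt x g w)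
    (hv : ContDiffOn ℝ ∞ (fun y => v ((extChartAt (𝓡 3) x).symm y)) (extChartAt (𝓡 3) x).target)
    (g' π' : M → Mat3) (N' V' : ℝ) (c K : JetIndex → ℝ) (hc : c = fieldJet x g π w N V)
    (hK : K = fieldJet x g' π' v N' V') :
    laplacian (fun z => w z ^ (2 / 3 : ℝ) • g z) (fun z => v z / w z) x =
      (w x ^ (2 / 3 : ℝ))⁻¹ * (jetLaplacian c K / w x - jetLaplacian c c * v x / w x ^ 2
        - 5 / 3 * jetGradInner c c K / w x ^ 2 + 5 / 3 * jetGradInner c c c * v x / w x ^ 3) := by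
  subst hc hK
  have hy := mem_extChartAt_target (I := 𝓡 3) x
  have hU : IsOpen (extChartAt (𝓡 3) x).target := isOpen_extChartAt_target x
  have hcov : covComp x (fun z => w z ^ (2 / 3 : ℝ) • g z) =
      fun y => w ((extChartAt (𝓡 3) x).symm y) ^ (2 / 3 : ℝ) • covComp x g y :=
    funext fun y => covComp_smul x _ g y
  have hx : (extChartAt (𝓡 3) x).symm (extChartAt (𝓡 3) x x) = x := extChartAt_to_inv x
  have hw0 := (h.factor_pos x).ne'
  rw [laplacian, hcov, coordLaplacian_conformal hU h.metric_smooth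
    (fun z _ => covComp_symm x h.symm z) (fun z hz => h.covComp_det_ne_zero hz) h.factor_smooth
    (fun z _ => h.factor_pos _) hy, coordLaplacian_div hU (covComp_symm x h.symm _) hv
    h.factor_smooth (fun z _ => h.factor_pos _) hy]
  simp only [pd_div _ (ContDiffOn.differentiableAt_of_isOpen hv hU hy)
    (ContDiffOn.differentiableAt_of_isOpen h.factor_smooth hU hy) (h.factor_pos _).ne', hx,
    jetLaplacian_fieldJet]
  have e : ∑ i, ∑ j, (covComp x g (extChartAt (𝓡 3) x x))⁻¹ i j *
      (pd i (fun y => w ((extChartAt (𝓡 3) x).symm y)) (extChartAt (𝓡 3) x x) *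
        (pd j (fun y => v ((extChartAt (𝓡 3) x).symm y)) (extChartAt (𝓡 3) x x) / w x -
          v x * pd j (fun y => w ((extChartAt (𝓡 3) x).symm y)) (extChartAt (𝓡 3) x x)
            / w x ^ 2)) =
      jetGradInner (fieldJet x g π w N V) (fieldJet x g π w N V) (fieldJet x g' π' v N' V') / w x
      - v x * jetGradInner (fieldJet x g π w N V) (fieldJet x g π w N V) (fieldJet x g π w N V)
        / w x ^ 2 := by
    simp only [jetGradInner, jetMetric_fieldJet, fieldJet, covComp_self, Finset.sum_div,
      Finset.mul_sum (a := v x), ← Finset.sum_sub_distrib]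
    refine Finset.sum_congr rfl fun i _ => Finset.sum_congr rfl fun j _ => ?_
    field_simp
  rw [e]
  have e1 : jetGradInner (fieldJet x g π w N V) (fieldJet x g π w N V)
      (fieldJet x g' π' v N' V') = ∑ i, ∑ j, (covComp x g (extChartAt (𝓡 3) x x))⁻¹ i j *
      (pd i (fun y => w ((extChartAt (𝓡 3) x).symm y)) (extChartAt (𝓡 3) x x) *
        pd j (fun y => v ((extChartAt (𝓡 3) x).symm y)) (extChartAt (𝓡 3) x x)) := by
    simp only [jetGradInner, jetMetric_fieldJet, fieldJet, covComp_self]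
  have e2 : jetGradInner (fieldJet x g π w N V) (fieldJet x g π w N V)
      (fieldJet x g π w N V) = ∑ i, ∑ j, (covComp x g (extChartAt (𝓡 3) x x))⁻¹ i j *
      (pd i (fun y => w ((extChartAt (𝓡 3) x).symm y)) (extChartAt (𝓡 3) x x) *
        pd j (fun y => w ((extChartAt (𝓡 3) x).symm y)) (extChartAt (𝓡 3) x x)) := by
    simp only [jetGradInner, jetMetric_fieldJet, fieldJet, covComp_self]
  rw [← e1, ← e2]
  field_simp
  ring

variable [T2Space M] [CompactSpace M]

/-- In the contractions each `e^{4φ}` of the metric cancels an `e^{-4φ}` of the momentum, so the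
kinetic part is that of the bracket `Q` with the untransformed metric. The factor enters otherwise
through `√(e^{4φ} g) = e^{6φ} √g` and the curvature. -/
theorem transformedConstraint_eq (Λ : ℝ) {φ : M → ℝ}
    (h : RegularAt x g fun z => Real.exp (6 * φ z)) (π : M → Mat3) :
    transformedConstraint Λ φ g π x =
      jetConstraint (fieldJet x g π (fun z => Real.exp (6 * φ z)) (densIntegral (momTrace g π))
        (densIntegral (sqrtDet g))) + 2 * Λ := by
  have hdet := h.det_pos x
  have hconf : confMetric φ g = fun z => Real.exp (6 * φ z) ^ (2 / 3 : ℝ) • g z := by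
    funext z
    rw [confMetric, ← Real.exp_mul]
    congr 2
    ring
  have hE : Real.exp (4 * φ x) * Real.exp (-4 * φ x) = 1 := by
    rw [← Real.exp_add]
    simp
  have hw : Real.exp (4 * φ x) ^ 3 = Real.exp (6 * φ x) ^ 2 := by
    rw [← Real.exp_nat_mul, ← Real.exp_nat_mul]
    congr 1
    push_cast
    ring
  have hs : sqrtDet (confMetric φ g) x = Real.exp (6 * φ x) * Real.sqrt (g x).det := by
    rw [sqrtDet, confMetric, Matrix.det_smul, Fintype.card_fin, hw, Real.sqrt_mul (sq_nonneg _),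
      Real.sqrt_sq (Real.exp_pos _).le]
  have hs0 : Real.sqrt (g x).det ≠ 0 := (Real.sqrt_pos.2 hdet).ne'
  have hss : Real.sqrt (g x).det ^ 2 = (g x).det := Real.sq_sqrt hdet.le
  rw [jetConstraint, jetConformalCurvature_fieldJet h, ← hconf, jetMetric_fieldJet,
    transformedConstraint, scalarConstraint, hs]
  set Q : Mat3 := π x - ((1 / 3) * meanMomTrace g π * (1 - Real.exp (6 * φ x)) *
    Real.sqrt (g x).det) • (g x)⁻¹ with hQ
  have hmom : confMomentum φ g π x = Real.exp (-4 * φ x) • Q := rfl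
  have hsq : momSq (confMetric φ g) (confMomentum φ g π) x =
      ∑ a, ∑ b, ∑ c, ∑ d, g x a c * g x b d * Q a b * Q c d := by
    simp only [momSq, hmom, confMetric, Matrix.smul_apply, smul_eq_mul]
    refine Finset.sum_congr rfl fun a _ => Finset.sum_congr rfl fun b _ =>
      Finset.sum_congr rfl fun c _ => Finset.sum_congr rfl fun d _ => ?_
    linear_combination (Real.exp (4 * φ x) * Real.exp (-4 * φ x) + 1) *
      (g x a c * g x b d * Q a b * Q c d) * hE
  have htr : momTrace (confMetric φ g) (confMomentum φ g π) x = ∑ a, ∑ b, Q a b * g x a b := by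
    simp only [momTrace, hmom, confMetric, Matrix.smul_apply, smul_eq_mul]
    refine Finset.sum_congr rfl fun a _ => Finset.sum_congr rfl fun b _ => ?_
    linear_combination (Q a b * g x a b) * hE
  have hkin : kineticTerm (g x) (jetMomentum (fieldJet x g π (fun z => Real.exp (6 * φ z))
      (densIntegral (momTrace g π)) (densIntegral (sqrtDet g))))
      (densIntegral (momTrace g π) / densIntegral (sqrtDet g)) (Real.exp (6 * φ x)) =
      ((∑ a, ∑ b, ∑ c, ∑ d, g x a c * g x b d * Q a b * Q c d)
        - (∑ a, ∑ b, Q a b * g x a b) ^ 2 / 2) / (Real.exp (6 * φ x) ^ 2 * (g x).det) := rfl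
  rw [hsq, htr]
  refine Eq.trans ?_ (congrArg (fun t => t - scalarCurvature (confMetric φ g) x + 2 * Λ) hkin.symm)
  have alg : ∀ r D S W R : ℝ, r ≠ 0 → W ≠ 0 → r ^ 2 = D →
      (S / (W * r) - W * r * (R - 2 * Λ)) / (W * r) = S / (W ^ 2 * D) - R + 2 * Λ := by
    rintro r _ S W R hr hW rfl
    field_simp
    ring
  exact alg _ _ _ _ _ hs0 (Real.exp_pos _).ne' hss

end FixedFields
end Main
end
end ShapeDynamics

/-! ### Polynomial truncations of the fields, and the source term. -/

namespace ShapeDynamics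
noncomputable section

open JetIndex

/-- The polynomial family `∑ₖ εᵏ T₍ₖ₎` of tensor fields. -/
def polyTensor {M : Type*} {m : ℕ} (T : Fin m → M → Mat3) (ε : ℝ) (x : M) : Mat3 :=
  ∑ k : Fin m, ε ^ (k : ℕ) • T k x

theorem polyTensor_pow_smul {M : Type*} {m : ℕ} (s : ℝ) (T : Fin m → M → Mat3) (ε : ℝ) :
    polyTensor (fun k => s ^ (k : ℕ) • T k) ε = polyTensor T (s * ε) := by
  funext x
  simp only [polyTensor, Pi.smul_apply, smul_smul, mul_pow, mul_comm]

theorem polyTensor_apply {M : Type*} {m : ℕ} (T : Fin m → M → Mat3) (ε : ℝ) (x : M) (i j : Fin 3) :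
    polyTensor T ε x i j = ∑ k : Fin m, ε ^ (k : ℕ) * T k x i j := by
  simp [polyTensor, Matrix.sum_apply]

theorem epsCoeff_polyTensor_tensorCoeff {M : Type*} {T : ℝ → M → Mat3} {k m : ℕ} (hk : k < m) (x : M)
    (i j : Fin 3) :
    epsCoeff k (fun e => polyTensor (fun l : Fin m => tensorCoeff l T) e x i j) =
      epsCoeff k fun e => T e x i j := by
  simp only [polyTensor_apply]
  rw [epsCoeff_polynomial (fun l : Fin m => tensorCoeff l T x i j), dif_pos hk]
  rfl

theorem polyTensor_contDiffAt {M : Type*} {m : ℕ} (T : Fin m → M → Mat3) (x : M) (i j : Fin 3) :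
    ContDiffAt ℝ ∞ (fun e => polyTensor T e x i j) 0 := by
  simp only [polyTensor_apply]
  fun_prop

section Families

variable {M : Type*} [TopologicalSpace M] [ChartedSpace E3 M] [IsManifold (𝓡 3) ∞ M]

section Truncation

variable [T2Space M] [CompactSpace M] {n : ℕ}

/-- The coefficient of `εᵏ` in `∫ π` for polynomial families. -/
def momentumIntegralCoeff {m : ℕ} (h p : Fin m → M → Mat3) (k : ℕ) : ℝ :=
  densIntegral fun x : M => epsCoeff k fun ε => momTrace (polyTensor h ε) (polyTensor p ε) x

/-- The coefficient of `εᵏ` in `∫ √g` for a polynomial family. -/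
def volumeCoeff {m : ℕ} (h : Fin m → M → Mat3) (k : ℕ) : ℝ :=
  densIntegral fun x : M => epsCoeff k fun ε => sqrtDet (polyTensor h ε) x

/-- The coefficients `ω₍ᵢ₎`, `i < n`, continued by `ω₍ₙ₎ = 0`. -/
def extendByZero (w : Fin n → M → ℝ) (k : Fin (n + 1)) : M → ℝ :=
  if hk : (k : ℕ) < n then w ⟨k, hk⟩ else 0

/-- The polynomial curve of jets at `x` determined by the coefficients of the fields. -/
def truncatedJet (w : Fin n → M → ℝ) (h p : Fin (n + 1) → M → Mat3) (x : M) (ε : ℝ)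
    (i : JetIndex) : ℝ :=
  ∑ k : Fin (n + 1), ε ^ (k : ℕ) * fieldJet x (h k) (p k) (extendByZero w k)
    (momentumIntegralCoeff h p k) (volumeCoeff h k) i

/-- The source term: the coefficient of `εⁿ` of the transformed constraint, with opposite sign,
for the expansions in which `ω₍ₙ₎` is omitted. -/
def sourceTerm (w : Fin n → M → ℝ) (h p : Fin (n + 1) → M → Mat3) (x : M) : ℝ :=
  -epsCoeff n fun ε => jetConstraint (truncatedJet w h p x ε)

/-- Weighting by `sᵏ` is the substitution `ε ↦ s ε` in polynomial families, and the coefficients of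
the two integrals scale accordingly. They are integrals of pointwise coefficients, which makes this
valid for arbitrary tensor fields without smoothness or positivity. -/
theorem truncatedJet_pow_smul (s : ℝ) (w : Fin n → M → ℝ) (h p : Fin (n + 1) → M → Mat3) (x : M)
    (ε : ℝ) :
    truncatedJet (fun i => s ^ (i : ℕ) • w i) (fun k => s ^ (k : ℕ) • h k)
      (fun k => s ^ (k : ℕ) • p k) x ε = truncatedJet w h p x (s * ε) := by
  funext i
  refine Finset.sum_congr rfl fun k _ => ?_
  have hw : extendByZero (fun i => s ^ (i : ℕ) • w i) k = s ^ (k : ℕ) • extendByZero w k := by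
    unfold extendByZero
    split_ifs <;> simp
  have hN : momentumIntegralCoeff (fun k => s ^ (k : ℕ) • h k) (fun k => s ^ (k : ℕ) • p k) k =
      s ^ (k : ℕ) * momentumIntegralCoeff h p k := by
    simp only [momentumIntegralCoeff, polyTensor_pow_smul, ← densIntegral_const_mul]
    congr 1
    funext z
    exact epsCoeff_comp_mul_left k s fun ε => momTrace (polyTensor h ε) (polyTensor p ε) z
  have hV : volumeCoeff (fun k => s ^ (k : ℕ) • h k) k = s ^ (k : ℕ) * volumeCoeff h k := by
    simp only [volumeCoeff, polyTensor_pow_smul, ← densIntegral_const_mul]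
    congr 1
    funext z
    exact epsCoeff_comp_mul_left k s fun ε => sqrtDet (polyTensor h ε) z
  rw [hw, hN, hV, fieldJet_smul, Pi.smul_apply, smul_eq_mul]
  ring

theorem sourceTerm_pow_smul (s : ℝ) (w : Fin n → M → ℝ) (h p : Fin (n + 1) → M → Mat3) (x : M) :
    sourceTerm (fun i => s ^ (i : ℕ) • w i) (fun k => s ^ (k : ℕ) • h k)
      (fun k => s ^ (k : ℕ) • p k) x = s ^ n * sourceTerm w h p x := by
  simp only [sourceTerm, truncatedJet_pow_smul]
  rw [epsCoeff_comp_mul_left n s fun ε => jetConstraint (truncatedJet w h p x ε)]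
  ring

end Truncation

/-! ### Taylor coefficients of the jet of a smooth family. -/

namespace IsSmoothFamily

variable {δ : ℝ} {g π : ℝ → M → Mat3} {φ : ℝ → M → ℝ}

theorem zero_mem (hδ : 0 < δ) : (0 : ℝ) ∈ Set.Ioo (-δ) δ := ⟨neg_lt_zero.2 hδ, hδ⟩

theorem omega_smooth (hf : IsSmoothFamily δ g π φ) (c : M) :
    ContDiffOn ℝ ∞ (fun q : ℝ × E3 => Real.exp (6 * φ q.1 ((extChartAt (𝓡 3) c).symm q.2)))
      (Set.Ioo (-δ) δ ×ˢ (extChartAt (𝓡 3) c).target) :=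
  (contDiffOn_const.mul (hf.factor_smooth c)).exp

theorem regularAt (hf : IsSmoothFamily δ g π φ) {ε : ℝ} (hε : ε ∈ Set.Ioo (-δ) δ) (x : M) :
    RegularAt x (g ε) fun z => Real.exp (6 * φ ε z) where
  symm := (hf.metric ε hε).symm
  det_pos := (hf.metric ε hε).det_pos
  metric_smooth i j := contDiffOn_param_right
    (A := fun e y => covComp x (g e) y i j) (hf.metric_smooth x i j) hε
  factor_pos _ := Real.exp_pos _
  factor_smooth := contDiffOn_param_right
    (A := fun e y => Real.exp (6 * φ e ((extChartAt (𝓡 3) x).symm y))) (hf.omega_smooth x) hε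

theorem metric_contDiffAt (hδ : 0 < δ) (hf : IsSmoothFamily δ g π φ) (x : M) (i j : Fin 3) :
    ContDiffAt ℝ ∞ (fun e => g e x i j) 0 := by
  have h := contDiffOn_param_left (A := fun e y => covComp x (g e) y i j)
    (hf.metric_smooth x i j) (mem_extChartAt_target (I := 𝓡 3) x)
  simp only [covComp_self] at h
  exact h.contDiffAt (isOpen_Ioo.mem_nhds (zero_mem hδ))

theorem momentum_contDiffAt (hδ : 0 < δ) (hf : IsSmoothFamily δ g π φ) (x : M) (i j : Fin 3) :
    ContDiffAt ℝ ∞ (fun e => π e x i j) 0 := by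
  have h := contDiffOn_param_left (A := fun e y => densComp x (π e) y i j)
    (hf.momentum_smooth x i j) (mem_extChartAt_target (I := 𝓡 3) x)
  simp only [densComp_self] at h
  exact h.contDiffAt (isOpen_Ioo.mem_nhds (zero_mem hδ))

theorem momTrace_smooth (hf : IsSmoothFamily δ g π φ) (c : M) :
    ContDiffOn ℝ ∞ (fun q : ℝ × E3 => scalarDensComp c (momTrace (g q.1) (π q.1)) q.2)
      (Set.Ioo (-δ) δ ×ˢ (extChartAt (𝓡 3) c).target) :=
  (ContDiffOn.sum fun a _ => ContDiffOn.sum fun b _ =>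
    (hf.momentum_smooth c a b).mul (hf.metric_smooth c a b)).congr
    fun _ hq => scalarDensComp_momTrace _ _ hq.2

theorem sqrtDet_smooth (hf : IsSmoothFamily δ g π φ) (c : M) :
    ContDiffOn ℝ ∞ (fun q : ℝ × E3 => scalarDensComp c (sqrtDet (g q.1)) q.2)
      (Set.Ioo (-δ) δ ×ˢ (extChartAt (𝓡 3) c).target) := by
  simp only [scalarDensComp_sqrtDet]
  intro q hq
  have hopen : IsOpen (Set.Ioo (-δ) δ ×ˢ (extChartAt (𝓡 3) c).target) :=
    isOpen_Ioo.prod (isOpen_extChartAt_target c)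
  exact ((contDiffAt_matrix_det (A := fun q : ℝ × E3 => covComp c (g q.1) q.2) fun i j =>
    (hf.metric_smooth c i j).contDiffAt (hopen.mem_nhds hq)).sqrt
    ((hf.regularAt hq.1 c).covComp_det_ne_zero hq.2)).contDiffWithinAt

theorem covComp_tensorCoeff (hδ : 0 < δ) (hf : IsSmoothFamily δ g π φ) (c : M) (k : ℕ) (y : E3)
    (i j : Fin 3) :
    covComp c (tensorCoeff k g) y i j = epsCoeff k fun e => covComp c (g e) y i j := by
  have hg := hf.metric_contDiffAt hδ ((extChartAt (𝓡 3) c).symm y)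
  simp only [covComp, Matrix.mul_apply, Matrix.transpose_apply]
  rw [epsCoeff_sum fun b _ => (ContDiffAt.sum fun a _ => contDiffAt_const.mul (hg a b)).mul
    contDiffAt_const]
  refine Finset.sum_congr rfl fun b _ => ?_
  rw [epsCoeff_mul_const, epsCoeff_sum fun a _ => contDiffAt_const.mul (hg a b)]
  simp only [epsCoeff_const_mul, tensorCoeff, Matrix.of_apply]

/-- At a point the trace is a fixed polynomial in the components, and the truncation has the same
coefficients up to order `k`, so `epsCoeff_comp_congr` applies. -/
theorem epsCoeff_momTrace (hδ : 0 < δ) (hf : IsSmoothFamily δ g π φ) {k m : ℕ} (hk : k < m)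
    (x : M) :
    epsCoeff k (fun e => momTrace (polyTensor (fun l : Fin m => tensorCoeff l g) e)
      (polyTensor (fun l : Fin m => tensorCoeff l π) e) x) =
      epsCoeff k fun e => momTrace (g e) (π e) x := by
  let F : (Bool × Fin 3 × Fin 3 → ℝ) → ℝ := fun c =>
    ∑ a, ∑ b, c (true, a, b) * c (false, a, b)
  have hF : ContDiff ℝ ∞ F := by
    refine ContDiff.sum fun a _ => ContDiff.sum fun b _ => ?_
    exact (contDiff_apply ℝ ℝ _).mul (contDiff_apply ℝ ℝ _)
  refine epsCoeff_comp_congr (F := F)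
    (c₁ := fun i e => cond i.1 (polyTensor (fun l : Fin m => tensorCoeff l π) e x i.2.1 i.2.2)
      (polyTensor (fun l : Fin m => tensorCoeff l g) e x i.2.1 i.2.2))
    (c₂ := fun i e => cond i.1 (π e x i.2.1 i.2.2) (g e x i.2.1 i.2.2)) ?_ ?_ ?_ hF.contDiffAt
  · rintro ⟨_ | _, a, b⟩ <;> exact polyTensor_contDiffAt _ x a b
  · rintro ⟨_ | _, a, b⟩
    · exact hf.metric_contDiffAt hδ x a b
    · exact hf.momentum_contDiffAt hδ x a b
  · rintro ⟨_ | _, a, b⟩ l hl <;>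
      exact epsCoeff_polyTensor_tensorCoeff (hl.trans_lt hk) x a b

theorem epsCoeff_sqrtDet (hδ : 0 < δ) (hf : IsSmoothFamily δ g π φ) {k m : ℕ} (hk : k < m)
    (x : M) :
    epsCoeff k (fun e => sqrtDet (polyTensor (fun l : Fin m => tensorCoeff l g) e) x) =
      epsCoeff k fun e => sqrtDet (g e) x := by
  let F : (Fin 3 × Fin 3 → ℝ) → ℝ := fun c => Real.sqrt (Matrix.of fun i j => c (i, j) : Mat3).det
  -- The true family is taken as the first curve because smoothness of the square root is required
  -- at its value for `ε = 0`, where the metric has positive determinant.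
  refine (epsCoeff_comp_congr (F := F) (c₁ := fun i e => g e x i.1 i.2)
    (c₂ := fun i e => polyTensor (fun l : Fin m => tensorCoeff l g) e x i.1 i.2)
    (fun i => hf.metric_contDiffAt hδ x _ _) (fun i => polyTensor_contDiffAt _ x _ _) ?_ ?_).symm
  · intro i l hl
    exact (epsCoeff_polyTensor_tensorCoeff (hl.trans_lt hk) x _ _).symm
  · refine (contDiffAt_matrix_det (A := fun c : Fin 3 × Fin 3 → ℝ =>
      (Matrix.of fun i j => c (i, j) : Mat3)) fun i j =>
        (contDiff_apply ℝ ℝ (i, j)).contDiffAt).sqrt ?_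
    exact ((hf.metric 0 (zero_mem hδ)).det_pos x).ne'

section Compact

variable [T2Space M] [CompactSpace M]

/-- The curve of jets at `x` of a family of fields. -/
def _root_.ShapeDynamics.familyJet (g π : ℝ → M → Mat3) (φ : ℝ → M → ℝ) (x : M) (ε : ℝ) :
    JetIndex → ℝ :=
  fieldJet x (g ε) (π ε) (fun z => Real.exp (6 * φ ε z)) (densIntegral (momTrace (g ε) (π ε)))
    (densIntegral (sqrtDet (g ε)))

theorem familyJet_contDiffAt (hδ : 0 < δ) (hf : IsSmoothFamily δ g π φ) (x : M) (i : JetIndex) :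
    ContDiffAt ℝ ∞ (fun e => familyJet g π φ x e i) 0 := by
  have h0 := zero_mem hδ
  have hI := isOpen_Ioo.mem_nhds h0
  have hU : IsOpen (extChartAt (𝓡 3) x).target := isOpen_extChartAt_target x
  have hy := mem_extChartAt_target (I := 𝓡 3) x
  have hA := fun i j => hf.metric_smooth x i j
  have hW := hf.omega_smooth x
  have along : ∀ A : ℝ → E3 → ℝ, ContDiffOn ℝ ∞ (fun q : ℝ × E3 => A q.1 q.2)
      (Set.Ioo (-δ) δ ×ˢ (extChartAt (𝓡 3) x).target) →
      ContDiffAt ℝ ∞ (fun e => A e (extChartAt (𝓡 3) x x)) 0 := fun A hA =>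
    (contDiffOn_param_left hA hy).contDiffAt hI
  have along₁ : ∀ (A : ℝ → E3 → ℝ) (m : Fin 3), ContDiffOn ℝ ∞ (fun q : ℝ × E3 => A q.1 q.2)
      (Set.Ioo (-δ) δ ×ˢ (extChartAt (𝓡 3) x).target) →
      ContDiffAt ℝ ∞ (fun e => pd m (A e) (extChartAt (𝓡 3) x x)) 0 := fun A m hA =>
    along (fun e => pd m (A e)) (contDiffOn_param_pd isOpen_Ioo hU hA m)
  have along₂ : ∀ (A : ℝ → E3 → ℝ) (m l : Fin 3), ContDiffOn ℝ ∞ (fun q : ℝ × E3 => A q.1 q.2)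
      (Set.Ioo (-δ) δ ×ˢ (extChartAt (𝓡 3) x).target) →
      ContDiffAt ℝ ∞ (fun e => pd m (pd l (A e)) (extChartAt (𝓡 3) x x)) 0 := fun A m l hA =>
    along₁ (fun e => pd l (A e)) m (contDiffOn_param_pd isOpen_Ioo hU hA l)
  cases i with
  | metric i j => exact hf.metric_contDiffAt hδ x i j
  | metricDeriv m i j => exact along₁ (fun e y => covComp x (g e) y i j) m (hA i j)
  | metricDeriv₂ m l i j => exact along₂ (fun e y => covComp x (g e) y i j) m l (hA i j)
  | momentum i j => exact hf.momentum_contDiffAt hδ x i j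
  | momentumIntegral => exact contDiffAt_densIntegral isOpen_Ioo h0 hf.momTrace_smooth
  | volume => exact contDiffAt_densIntegral isOpen_Ioo h0 hf.sqrtDet_smooth
  | factor =>
    have h1 := along (fun e y => Real.exp (6 * φ e ((extChartAt (𝓡 3) x).symm y))) hW
    simp only [extChartAt_to_inv] at h1
    exact h1
  | factorDeriv i =>
    exact along₁ (fun e y => Real.exp (6 * φ e ((extChartAt (𝓡 3) x).symm y))) i hW
  | factorDeriv₂ i j =>
    exact along₂ (fun e y => Real.exp (6 * φ e ((extChartAt (𝓡 3) x).symm y))) i j hW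

/-- Coefficient extraction commutes with spatial derivatives and with integration over the compact
manifold. For the integrals it moreover suffices to know the fields up to order `k`, so the
coefficients of the jet are determined by those of the fields. -/
theorem epsCoeff_familyJet (hδ : 0 < δ) (hf : IsSmoothFamily δ g π φ) (x : M) {k m : ℕ}
    (hk : k < m) (i : JetIndex) :
    epsCoeff k (fun e => familyJet g π φ x e i) =
      fieldJet x (tensorCoeff k g) (tensorCoeff k π) (omegaCoeff k φ)
        (momentumIntegralCoeff (fun l : Fin m => tensorCoeff l g)
          (fun l : Fin m => tensorCoeff l π) k)
        (volumeCoeff (fun l : Fin m => tensorCoeff l g) k) i := by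
  have h0 := zero_mem hδ
  have hU : IsOpen (extChartAt (𝓡 3) x).target := isOpen_extChartAt_target x
  have hy := mem_extChartAt_target (I := 𝓡 3) x
  have hcov : ∀ i j, (fun y => covComp x (tensorCoeff k g) y i j) =
      fun y => epsCoeff k fun e => covComp x (g e) y i j := fun i j =>
    funext fun y => hf.covComp_tensorCoeff hδ x k y i j
  cases i with
  | metric i j => rfl
  | metricDeriv m i j =>
    simp only [fieldJet, hcov]
    exact epsCoeff_pd (A := fun e y => covComp x (g e) y i j) isOpen_Ioo h0 hU
      (hf.metric_smooth x i j) hy m k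
  | metricDeriv₂ m l i j =>
    simp only [fieldJet, hcov]
    exact epsCoeff_pd_pd (A := fun e y => covComp x (g e) y i j) isOpen_Ioo h0 hU
      (hf.metric_smooth x i j) hy m l k
  | momentum i j => rfl
  | momentumIntegral =>
    simp only [fieldJet, momentumIntegralCoeff, hf.epsCoeff_momTrace hδ hk]
    exact epsCoeff_densIntegral (ρ := fun e => momTrace (g e) (π e)) isOpen_Ioo h0
      hf.momTrace_smooth k
  | volume =>
    simp only [fieldJet, volumeCoeff, hf.epsCoeff_sqrtDet hδ hk]
    exact epsCoeff_densIntegral (ρ := fun e => sqrtDet (g e)) isOpen_Ioo h0 hf.sqrtDet_smooth k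
  | factor => rfl
  | factorDeriv i =>
    exact epsCoeff_pd (A := fun e y => Real.exp (6 * φ e ((extChartAt (𝓡 3) x).symm y)))
      isOpen_Ioo h0 hU (hf.omega_smooth x) hy i k
  | factorDeriv₂ i j =>
    exact epsCoeff_pd_pd (A := fun e y => Real.exp (6 * φ e ((extChartAt (𝓡 3) x).symm y)))
      isOpen_Ioo h0 hU (hf.omega_smooth x) hy i j k

end Compact
end IsSmoothFamily
end Families
end
end ShapeDynamics

/-! ### The mass term and the expansion at order `n`. -/

namespace ShapeDynamics
noncomputable section

open JetIndex

/-- The function `m²`, given by the background. -/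
def massSq {M : Type*} [TopologicalSpace M] [ChartedSpace E3 M] [IsManifold (𝓡 3) ∞ M]
    [T2Space M] [CompactSpace M] (g₀ π₀ : M → Mat3) (w₀ : M → ℝ) (x : M) : ℝ :=
  3 / 4 * (w₀ x * deriv (kineticTerm (g₀ x) (π₀ x) (meanMomTrace g₀ π₀)) (w₀ x)
    + 2 / 3 * scalarCurvature (fun z => w₀ z ^ (2 / 3 : ℝ) • g₀ z) x)

namespace IsSmoothFamily

variable {M : Type*} [TopologicalSpace M] [ChartedSpace E3 M] [IsManifold (𝓡 3) ∞ M]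
  [T2Space M] [CompactSpace M] {δ : ℝ} {g π : ℝ → M → Mat3} {φ : ℝ → M → ℝ}

theorem volume_pos [Nonempty M] (hδ : 0 < δ) (hf : IsSmoothFamily δ g π φ) :
    0 < densIntegral (sqrtDet (g 0)) := by
  have h0 := zero_mem hδ
  refine densIntegral_pos (fun z => Real.sqrt_pos.2 ((hf.metric 0 h0).det_pos z)) fun c => ?_
  exact contDiffOn_param_right (A := fun e y => scalarDensComp c (sqrtDet (g e)) y)
    (hf.sqrtDet_smooth c) h0

theorem contDiffAt_jetConstraint_familyJet (hδ : 0 < δ) (hf : IsSmoothFamily δ g π φ) (x : M) :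
    ContDiffAt ℝ ∞ jetConstraint fun i => familyJet g π φ x 0 i := by
  have h0 := zero_mem hδ
  have : Nonempty M := ⟨x⟩
  have hV := hf.volume_pos hδ
  refine contDiffAt_jetConstraint ?_ (Real.exp_pos _) hV.ne'
  exact ((hf.metric 0 h0).det_pos x).ne'

theorem transformedConstraint_eventuallyEq (Λ : ℝ) (hδ : 0 < δ) (hf : IsSmoothFamily δ g π φ)
    (x : M) :
    (fun e => transformedConstraint Λ (φ e) (g e) (π e) x) =ᶠ[𝓝 0]
      fun e => jetConstraint (fun i => familyJet g π φ x e i) + 2 * Λ := by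
  filter_upwards [isOpen_Ioo.mem_nhds (zero_mem hδ)] with e he
  exact transformedConstraint_eq Λ (hf.regularAt he x) (π e)

theorem contDiffAt_transformedConstraint (Λ : ℝ) (hδ : 0 < δ) (hf : IsSmoothFamily δ g π φ)
    (x : M) :
    ContDiffAt ℝ ∞ (fun e => transformedConstraint Λ (φ e) (g e) (π e) x) 0 := by
  refine ContDiffAt.congr_of_eventuallyEq ?_ (hf.transformedConstraint_eventuallyEq Λ hδ x)
  refine ContDiffAt.add ?_ contDiffAt_const
  exact ContDiffAt.comp (g := jetConstraint) (f := fun e i => familyJet g π φ x e i) 0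
    (hf.contDiffAt_jetConstraint_familyJet hδ x)
    (contDiffAt_pi.2 fun i => hf.familyJet_contDiffAt hδ x i)

/-- All terms of the differential containing derivatives of `ω₍ₙ₎` are absorbed by `4/3` times the
Laplacian of `ω₍ₙ₎ / ω₍₀₎`. What remains is multiplication of `ω₍ₙ₎` by a background function, and
`massSq` is `3/4 ω₍₀₎` times that multiplier. -/
theorem fderiv_jetConstraint_omega (hδ : 0 < δ) (hf : IsSmoothFamily δ g π φ) (n : ℕ) (x : M) :
    fderiv ℝ jetConstraint (fun i => familyJet g π φ x 0 i)
        (fieldJet x 0 0 (omegaCoeff n φ) 0 0) =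
      linearOperator (g 0) (omegaCoeff 0 φ) (massSq (g 0) (π 0) (omegaCoeff 0 φ))
        (omegaCoeff n φ) x := by
  have h0 := zero_mem hδ
  have : Nonempty M := ⟨x⟩
  have hV := hf.volume_pos hδ
  have hω : omegaCoeff 0 φ = fun z => Real.exp (6 * φ 0 z) :=
    funext fun z => epsCoeff_zero _
  have hreg := hf.regularAt h0 x
  have hv : ContDiffOn ℝ ∞ (fun y => omegaCoeff n φ ((extChartAt (𝓡 3) x).symm y))
      (extChartAt (𝓡 3) x).target :=
    contDiffOn_epsCoeff (A := fun e y => Real.exp (6 * φ e ((extChartAt (𝓡 3) x).symm y)))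
      isOpen_Ioo h0 (isOpen_extChartAt_target x) (hf.omega_smooth x) n
  have hzero : ∀ i j, (fun y => covComp x (0 : M → Mat3) y i j) = fun _ => 0 := by
    intro i j
    funext y
    simp [covComp]
  have hpd0 : ∀ l : Fin 3, (pd l fun _ => (0 : ℝ)) = fun _ => 0 := fun l =>
    funext fun y => pd_const l 0 y
  set K : JetIndex → ℝ := fieldJet x 0 0 (omegaCoeff n φ) 0 0 with hK
  set c : JetIndex → ℝ := fun i => familyJet g π φ x 0 i with hc
  have hlap := laplacian_div_fieldJet (v := omegaCoeff n φ) (π := π 0)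
    (N := densIntegral (momTrace (g 0) (π 0))) (V := densIntegral (sqrtDet (g 0)))
    hreg hv 0 0 0 0 c K rfl rfl
  have hconf : jetConformalCurvature c = _ := jetConformalCurvature_fieldJet (π := π 0)
    (N := densIntegral (momTrace (g 0) (π 0))) (V := densIntegral (sqrtDet (g 0))) hreg
  have hfd := fderiv_jetConstraint_factor (c := c) (K := K) ((hf.metric 0 h0).det_pos x).ne'
    ((hf.metric 0 h0).symm x) (Real.exp_pos _) hV.ne' (fun i j => rfl)
    (fun m i j => by simp only [hK, fieldJet, hzero, hpd0])
    (fun m l i j => by simp only [hK, fieldJet, hzero, hpd0]) (fun i j => rfl) rfl rfl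
  rw [hfd, linearOperator, massSq, hω, hlap, hconf]
  have e1 : K factor = omegaCoeff n φ x := rfl
  have e2 : c factor = Real.exp (6 * φ 0 x) := rfl
  have e3 : deriv (kineticTerm (jetMetric c) (jetMomentum c) (c momentumIntegral / c volume))
      (c factor) = deriv (kineticTerm (g 0 x) (π 0 x) (meanMomTrace (g 0) (π 0)))
        (Real.exp (6 * φ 0 x)) := rfl
  rw [e3, e1, e2]
  have hw0 := (Real.exp_pos (6 * φ 0 x)).ne'
  have hw1 := (Real.rpow_pos_of_pos (Real.exp_pos (6 * φ 0 x)) (2 / 3)).ne'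
  field_simp
  ring

theorem epsCoeff_transformedConstraint (Λ : ℝ) (hδ : 0 < δ) (hf : IsSmoothFamily δ g π φ)
    {n : ℕ} (hn : 0 < n) (x : M) :
    epsCoeff n (fun e => transformedConstraint Λ (φ e) (g e) (π e) x) =
      linearOperator (g 0) (omegaCoeff 0 φ) (massSq (g 0) (π 0) (omegaCoeff 0 φ))
          (omegaCoeff n φ) x
        - sourceTerm (fun i : Fin n => omegaCoeff i φ)
          (fun k : Fin (n + 1) => tensorCoeff k g) (fun k : Fin (n + 1) => tensorCoeff k π) x := by
  set w : Fin n → M → ℝ := fun i => omegaCoeff i φ with hw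
  set h : Fin (n + 1) → M → Mat3 := fun k => tensorCoeff k g with hh
  set p : Fin (n + 1) → M → Mat3 := fun k => tensorCoeff k π with hp
  have htr : ∀ k (hk : k < n + 1) i, epsCoeff k (fun e => truncatedJet w h p x e i) =
      fieldJet x (tensorCoeff k g) (tensorCoeff k π) (extendByZero w ⟨k, hk⟩)
        (momentumIntegralCoeff h p k) (volumeCoeff h k) i := fun k hk i => by
    have := epsCoeff_polynomial (k := k) fun l : Fin (n + 1) => fieldJet x (h l) (p l)
      (extendByZero w l) (momentumIntegralCoeff h p l) (volumeCoeff h l) i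
    rw [dif_pos hk] at this
    exact this
  have hfam : ∀ k < n + 1, ∀ i, epsCoeff k (fun e => familyJet g π φ x e i) =
      fieldJet x (tensorCoeff k g) (tensorCoeff k π) (omegaCoeff k φ)
        (momentumIntegralCoeff h p k) (volumeCoeff h k) i := fun k hk i =>
    hf.epsCoeff_familyJet hδ x hk i
  have hlow : ∀ i, ∀ k < n, epsCoeff k (fun e => familyJet g π φ x e i) =
      epsCoeff k (fun e => truncatedJet w h p x e i) := fun i k hk => by
    rw [htr k (hk.trans n.lt_succ_self), hfam k (hk.trans n.lt_succ_self), extendByZero,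
      dif_pos hk]
  -- At order `n` the metric, momentum and integral entries agree, and the truncation has conformal
  -- factor zero, so the difference is the jet of `ω₍ₙ₎` alone.
  have htop : (fun i => epsCoeff n (fun e => familyJet g π φ x e i) -
      epsCoeff n (fun e => truncatedJet w h p x e i)) =
      fieldJet x 0 0 (omegaCoeff n φ) 0 0 := by
    have hext : extendByZero w ⟨n, n.lt_succ_self⟩ = 0 := dif_neg (lt_irrefl n)
    have hzero : ∀ i j, (fun y => covComp x (0 : M → Mat3) y i j) = fun _ => 0 := by
      intro i j
      funext y
      simp [covComp]
    have hpd0 : ∀ l : Fin 3, (pd l fun _ => (0 : ℝ)) = fun _ => 0 := fun l =>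
      funext fun y => pd_const l 0 y
    funext i
    rw [htr n n.lt_succ_self, hfam n n.lt_succ_self, hext]
    cases i <;> simp [fieldJet, hzero, hpd0]
  have key := epsCoeff_comp_sub hn (F := jetConstraint)
    (c₁ := fun i e => familyJet g π φ x e i) (c₂ := fun i e => truncatedJet w h p x e i)
    (fun i => hf.familyJet_contDiffAt hδ x i)
    (fun i => by simp only [truncatedJet]; fun_prop) hlow
    (hf.contDiffAt_jetConstraint_familyJet hδ x)
  rw [htop, hf.fderiv_jetConstraint_omega hδ n x] at key
  -- The constant `2Λ` affects order zero only, so neither the operator nor the source depends on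
  -- `Λ`.
  rw [epsCoeff_congr (hf.transformedConstraint_eventuallyEq Λ hδ x), epsCoeff_add_const hn,
    sourceTerm, ← key]
  ring

end IsSmoothFamily
end
end ShapeDynamics

theorem mainTheorem2 {M : Type*} [TopologicalSpace M] [ChartedSpace ShapeDynamics.E3 M]
    [IsManifold (𝓡 3) ∞ M] [T2Space M] [CompactSpace M] (n : ℕ) (hn : 0 < n) :
    ∃ (msq : (M → ShapeDynamics.Mat3) → (M → ShapeDynamics.Mat3) → (M → ℝ) → M → ℝ)
      (f : (Fin n → M → ℝ) → (Fin (n + 1) → M → ShapeDynamics.Mat3) →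
        (Fin (n + 1) → M → ShapeDynamics.Mat3) → M → ℝ),
      (∀ (s : ℝ) (w : Fin n → M → ℝ) (h p : Fin (n + 1) → M → ShapeDynamics.Mat3) (x : M),
        f (fun i => s ^ (i : ℕ) • w i) (fun k => s ^ (k : ℕ) • h k)
          (fun k => s ^ (k : ℕ) • p k) x = s ^ n * f w h p x) ∧
      ∀ (Λ δ : ℝ) (g π : ℝ → M → ShapeDynamics.Mat3) (φ : ℝ → M → ℝ), 0 < δ →
        ShapeDynamics.IsSmoothFamily δ g π φ →
        (∀ x, ContDiffAt ℝ ∞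
          (fun ε => ShapeDynamics.transformedConstraint Λ (φ ε) (g ε) (π ε) x) 0) ∧
        (∀ x, ShapeDynamics.epsCoeff n
            (fun ε => ShapeDynamics.transformedConstraint Λ (φ ε) (g ε) (π ε) x) =
          ShapeDynamics.linearOperator (g 0) (ShapeDynamics.omegaCoeff 0 φ)
              (msq (g 0) (π 0) (ShapeDynamics.omegaCoeff 0 φ))
              (ShapeDynamics.omegaCoeff n φ) x
            - f (fun i => ShapeDynamics.omegaCoeff i φ)
                (fun k => ShapeDynamics.tensorCoeff k g)
                (fun k => ShapeDynamics.tensorCoeff k π) x) ∧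
        (∀ Hdual : ℝ → ℝ,
          (∀ᶠ ε in 𝓝 0, ∀ x,
            ShapeDynamics.transformedConstraint Λ (φ ε) (g ε) (π ε) x = Hdual ε) →
          ∀ x, ShapeDynamics.epsCoeff n Hdual =
            ShapeDynamics.linearOperator (g 0) (ShapeDynamics.omegaCoeff 0 φ)
                (msq (g 0) (π 0) (ShapeDynamics.omegaCoeff 0 φ))
                (ShapeDynamics.omegaCoeff n φ) x
              - f (fun i => ShapeDynamics.omegaCoeff i φ)
                  (fun k => ShapeDynamics.tensorCoeff k g)
                  (fun k => ShapeDynamics.tensorCoeff k π) x) := by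
  -- Both witnesses are fixed before `Λ` and the family, which expresses that they depend on their
  -- listed arguments only.
  refine ⟨ShapeDynamics.massSq, ShapeDynamics.sourceTerm,
    ShapeDynamics.sourceTerm_pow_smul, fun Λ δ g π φ hδ hf => ⟨?_, ?_, ?_⟩⟩
  · exact hf.contDiffAt_transformedConstraint Λ hδ
  · exact hf.epsCoeff_transformedConstraint Λ hδ hn
  · intro Hdual hH x
    rw [← hf.epsCoeff_transformedConstraint Λ hδ hn x]
    refine ShapeDynamics.epsCoeff_congr ?_
    filter_upwards [hH] with ε hε using (hε x).symm
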